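/- All graphs are finite and simple. For $m\in\mathbb N$, a graph $G$ is *$m$-joined* if for every pair of disjoint sets $A,B\subset V(G)$ with $|A|=|B|=m$ there is an edge of $G$ between $A$ and $B$. A *$K_t$-subdivision* in $G$ consists of $t$ distinct vertices of $G$ (the branch vertices) and, for every pair of branch vertices, a path of $G$ (of length at least $1$) joining them, such that the interiors of these $\binom t2$ branching paths contain no branch vertex and are pairwise disjoint. It is *spanning* if every vertex of $G$ lies on it, and *nearly-balanced* if there is a positive integer $\ell$ such that every branching path has length (number of edges) between $\ell-1$ and $\ell+1$. **Theorem.** For every real $\mu>0$ there exist real constants $c,\varepsilon\in(0,1]$ and $n_0\in\mathbb N$ such that the following holds for all $n\ge n_0$. If $G$ is an $n$-vertex $\lceil\varepsilon n\rceil$-joined graph with minimum degree $\delta(G)\ge\mu n$, then for every integer $t$ with $2\le t\le c\sqrt n$ the graph $G$ contains a spanning nearly-balanced $K_t$-subdivision. -/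

import Mathlib

namespace SimpleGraph

universe u v

/-- A graph is `m`-joined if there is an edge between any two disjoint vertex sets of size
exactly `m` (that is, there is no bipartite hole of size `m`). -/
def IsJoined {V : Type u} (G : SimpleGraph V) (m : ℕ) : Prop :=
  ∀ A B : Finset V, A.card = m → B.card = m → Disjoint A B → ∃ a ∈ A, ∃ b ∈ B, G.Adj a b

/-- A subdivision of `H` contained in the graph `G`: distinct branch vertices of `G`, one for each
vertex of `H`, and for each edge `xy` of `H` a path of `G` joining the branch vertices of `x` and
`y` (a single path for the edge, so the path of `yx` is the path of `xy` reversed), such that the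
interiors of these paths avoid all branch vertices and are pairwise disjoint. A path of length one
means that the edge is not subdivided. -/
structure SubdivisionIn {W : Type v} {V : Type u} (H : SimpleGraph W) (G : SimpleGraph V) where
  /-- the branch vertices -/
  branch : W → V
  branch_injective : Function.Injective branch
  /-- the branching paths -/
  path : ∀ {x y : W}, H.Adj x y → G.Walk (branch x) (branch y)
  path_symm : ∀ {x y : W} (h : H.Adj x y), path h.symm = (path h).reverse
  isPath : ∀ {x y : W} (h : H.Adj x y), (path h).IsPath
  branch_mem : ∀ {x y : W} (h : H.Adj x y) (z : W),
    branch z ∈ (path h).support → z = x ∨ z = y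
  internally_disjoint : ∀ {x y x' y' : W} (h : H.Adj x y) (h' : H.Adj x' y'),
    s(x, y) ≠ s(x', y') → ∀ p : V, p ∈ (path h).support → p ∈ (path h').support →
      p ∈ Set.range branch

namespace SubdivisionIn

variable {W : Type v} {V : Type u} {H : SimpleGraph W} {G : SimpleGraph V}

/-- The subdivision as a subgraph of `G`: the union of the branch vertices and of the branching
paths. -/
def toSubgraph (S : SubdivisionIn H G) : G.Subgraph :=
  (⨆ x : W, G.singletonSubgraph (S.branch x)) ⊔
    ⨆ (x : W) (y : W) (h : H.Adj x y), (S.path h).toSubgraph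

/-- A subdivision is nearly-balanced if, for some positive integer `l`, all its branching paths
have length between `l - 1` and `l + 1`. -/
def IsNearlyBalanced (S : SubdivisionIn H G) : Prop :=
  ∃ l : ℕ, 1 ≤ l ∧ ∀ (x y : W) (h : H.Adj x y),
    l - 1 ≤ (S.path h).length ∧ (S.path h).length ≤ l + 1

end SubdivisionIn

end SimpleGraph

/-! The proof is by absorption with exact control of orders. Let N be the number of pairs of branch
vertices. The branch vertices are chosen with many neighbours in a small reservoir R. For each pair,
an absorbing path starts next to one branch vertex and ends in a vertex with many neighbours in R.
It contains k gadgets, and each gadget can swallow any one vertex outside a tiny exceptional set of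
at most h vertices. A segment entering and leaving through R then leads from the absorbing path to
the other branch vertex.

The segments have prescribed orders, chosen so that exactly Nk vertices remain. Hall's theorem hands
each gadget one of them, so each path gains exactly k vertices, has the prescribed order, and
nothing is left uncovered. Hall's condition holds because each gadget accepts at least half of the
remaining vertices (2h ≤ Nk), and each of these is accepted by at least half of the gadgets: at most
2h vertices violate the latter, and they are put on the absorbing paths in advance
(`IsJoined.exists_absorbing_paths`).

A gadget is a chain of slots with one filler path fewer than slots. Shifting the fillers moves the
open slot, and a vertex adjacent to both sides of a slot can close it. By the minimum degree
condition each new slot can be given a common neighbourhood containing a proportion θ² of the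
vertices not yet accepted, so d slots leave at most (1 - θ²)^d n exceptions
(`IsJoined.exists_slotChain`).

Joinedness supplies two-vertex connections between arbitrary vertices (`IsJoined.exists_connector`)
and, by depth-first search, paths of any prescribed order in large sets (`IsJoined.exists_path_in`).
-/

namespace SimpleGraph

variable {V : Type*} {G : SimpleGraph V}

/-! ### Paths with prescribed vertex sets, and absorbers -/

/-- There is a path of `G` from `a` to `b` whose vertex set is exactly `S`. -/
def HasPathOn (G : SimpleGraph V) (a b : V) (S : Finset V) : Prop :=
  ∃ p : G.Walk a b, p.IsPath ∧ ∀ x, x ∈ p.support ↔ x ∈ S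

theorem HasPathOn.singleton (a : V) : G.HasPathOn a a {a} :=
  ⟨Walk.nil, Walk.IsPath.nil, by simp⟩

theorem HasPathOn.congr {a b : V} {S T : Finset V} (h : G.HasPathOn a b S) (hST : S = T) :
    G.HasPathOn a b T := hST ▸ h

theorem HasPathOn.append [DecidableEq V] {a b c d : V} {S T : Finset V} (h₁ : G.HasPathOn a b S)
    (h₂ : G.HasPathOn c d T) (hbc : G.Adj b c) (hd : Disjoint S T) :
    G.HasPathOn a d (S ∪ T) := by
  obtain ⟨p, hp, hpS⟩ := h₁
  obtain ⟨q, hq, hqT⟩ := h₂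
  refine ⟨p.append (Walk.cons hbc q), ?_, ?_⟩
  · rw [Walk.isPath_def, Walk.support_append, Walk.support_cons, List.tail_cons,
      List.nodup_append]
    refine ⟨hp.support_nodup, hq.support_nodup, ?_⟩
    rintro x hx y hy rfl
    exact Finset.disjoint_left.1 hd ((hpS x).1 hx) ((hqT x).1 hy)
  · intro x
    rw [Walk.support_append, Walk.support_cons, List.tail_cons, List.mem_append, hpS, hqT,
      Finset.mem_union]

theorem HasPathOn.pair [DecidableEq V] {a b : V} (h : G.Adj a b) : G.HasPathOn a b {a, b} :=
  ((HasPathOn.singleton a).append (HasPathOn.singleton b) h (by simpa using h.ne)).congr rfl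

theorem HasPathOn.card_eq {a b : V} {S : Finset V} {p : G.Walk a b} (hp : p.IsPath)
    (hS : ∀ x, x ∈ p.support ↔ x ∈ S) : S.card = p.length + 1 := by
  classical
  have : S = p.support.toFinset := by
    ext x
    simp [hS]
  rw [this, List.toFinset_card_of_nodup hp.support_nodup, Walk.length_support]

theorem HasPathOn.left_mem {a b : V} {S : Finset V} (h : G.HasPathOn a b S) : a ∈ S := by
  obtain ⟨p, -, hS⟩ := h
  exact (hS a).1 p.start_mem_support

theorem HasPathOn.right_mem {a b : V} {S : Finset V} (h : G.HasPathOn a b S) : b ∈ S := by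
  obtain ⟨p, -, hS⟩ := h
  exact (hS b).1 p.end_mem_support

/-- `A` absorbs any transversal of the sets `C t`, `t ∈ T`, into a path from `a` to `b`. -/
def Absorbs {ι : Type*} [DecidableEq V] (G : SimpleGraph V) (C : ι → Finset V) (a b : V)
    (A : Finset V) (T : Finset ι) : Prop :=
  ∀ v : ι → V, Set.InjOn v T → (∀ t ∈ T, v t ∈ C t) → (∀ t ∈ T, v t ∉ A) →
    G.HasPathOn a b (A ∪ T.image v)

theorem HasPathOn.absorbs {ι : Type*} [DecidableEq V] {C : ι → Finset V} {a b : V}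
    {A : Finset V} (h : G.HasPathOn a b A) : G.Absorbs C a b A ∅ := by
  intro v _ _ _
  simpa using h

theorem Absorbs.append {ι : Type*} [DecidableEq V] [DecidableEq ι] {C : ι → Finset V}
    {a b c d : V} {A A' : Finset V} {T T' : Finset ι} (h₁ : G.Absorbs C a b A T)
    (h₂ : G.Absorbs C c d A' T') (hbc : G.Adj b c) (hA : Disjoint A A') (hT : Disjoint T T') :
    G.Absorbs C a d (A ∪ A') (T ∪ T') := by
  intro v hv hC hA'
  have k₁ := h₁ v (hv.mono (by simp)) (fun t ht => hC t (by simp [ht]))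
    (fun t ht h => hA' t (by simp [ht]) (by simp [h]))
  have k₂ := h₂ v (hv.mono (by simp)) (fun t ht => hC t (by simp [ht]))
    (fun t ht h => hA' t (by simp [ht]) (by simp [h]))
  refine (k₁.append k₂ hbc ?_).congr ?_
  · rw [Finset.disjoint_union_left, Finset.disjoint_union_right, Finset.disjoint_union_right]
    refine ⟨⟨hA, ?_⟩, ?_, ?_⟩
    · rw [Finset.disjoint_right]
      intro x hx hxA
      obtain ⟨t, ht, rfl⟩ := Finset.mem_image.1 hx
      exact hA' t (by simp [ht]) (by simp [hxA])
    · rw [Finset.disjoint_left]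
      intro x hx hxA
      obtain ⟨t, ht, rfl⟩ := Finset.mem_image.1 hx
      exact hA' t (by simp [ht]) (by simp [hxA])
    · rw [Finset.disjoint_left]
      intro x hx hx'
      obtain ⟨t, ht, rfl⟩ := Finset.mem_image.1 hx
      obtain ⟨t', ht', he⟩ := Finset.mem_image.1 hx'
      have : t' = t := hv (by simp [ht']) (by simp [ht]) he
      subst this
      exact Finset.disjoint_left.1 hT ht ht'
  · rw [Finset.image_union]
    ext x
    simp only [Finset.mem_union]
    tauto

/-! ### Slot chains, the gadgets that absorb one vertex -/

/-- A path from `e` to `y` on `A` with an open slot between `x` and `y`: the slot can be filled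
by any path outside `A`, and any vertex of `C` outside `A` can be inserted somewhere. -/
def IsSlotChain [DecidableEq V] (G : SimpleGraph V) (A C : Finset V) (e x y : V) : Prop :=
  (∀ a b Q, G.HasPathOn a b Q → G.Adj x a → G.Adj b y → Disjoint A Q →
    G.HasPathOn e y (A ∪ Q)) ∧
  ∀ v ∈ C, v ∉ A → G.HasPathOn e y (insert v A)

/-- The base case: a single open slot, whose sides need not be adjacent. No vertex is claimed to be
insertable yet. -/
theorem isSlotChain_pair [DecidableEq V] {x y : V} (hxy : x ≠ y) :
    G.IsSlotChain {x, y} ∅ x x y := by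
  refine ⟨?_, by simp⟩
  intro a b Q hQ ha hb hd
  have hxQ : x ∉ Q := Finset.disjoint_left.1 hd (by simp)
  have hyQ : y ∉ Q := Finset.disjoint_left.1 hd (by simp)
  refine (((HasPathOn.singleton x).append hQ ha (by simpa using hxQ)).append
    (HasPathOn.singleton y) hb (by simp [hxy.symm, hyQ])).congr ?_
  ext z
  simp only [Finset.mem_union, Finset.mem_singleton, Finset.mem_insert]
  tauto

/-- The filler `Q` fits both the old slot (between `x` and `y`) and the new one (between `x'` and
`y'`), since `a` is adjacent to `x` and `x'`, and `b` to `y` and `y'`. It closes whichever of the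
two is not needed; `L` joins the old chain to the new slot. -/
theorem IsSlotChain.extend [Fintype V] [DecidableEq V] [DecidableRel G.Adj] {A C Q L : Finset V}
    {e x y x' y' a b w w' : V}
    (h : G.IsSlotChain A C e x y) (hQ : G.HasPathOn a b Q) (hL : G.HasPathOn w w' L)
    (hxa : G.Adj x a) (hby : G.Adj b y) (hxa' : G.Adj x' a) (hby' : G.Adj b y')
    (hyw : G.Adj y w) (hwx : G.Adj w' x') (hxy : x' ≠ y')
    (hAQ : Disjoint A Q) (hAL : Disjoint A L) (hQL : Disjoint Q L)
    (hx : x' ∉ A ∪ Q ∪ L) (hy : y' ∉ A ∪ Q ∪ L) :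
    G.IsSlotChain (A ∪ Q ∪ L ∪ {x', y'}) (C ∪ (G.neighborFinset x' ∩ G.neighborFinset y'))
      e x' y' := by
  simp only [Finset.mem_union, not_or] at hx hy
  -- Here `Q` closes the old slot, and the new slot stays open.
  have key : ∀ a₁ b₁ Q₁, G.HasPathOn a₁ b₁ Q₁ → G.Adj x' a₁ → G.Adj b₁ y' →
      Disjoint (A ∪ Q ∪ L ∪ {x', y'}) Q₁ → G.HasPathOn e y' (A ∪ Q ∪ L ∪ {x', y'} ∪ Q₁) := by
    intro a₁ b₁ Q₁ hQ₁ ha₁ hb₁ hd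
    simp only [Finset.disjoint_union_left, Finset.disjoint_insert_left,
      Finset.disjoint_singleton_left] at hd
    have h1 := (h.1 a b Q hQ hxa hby hAQ).append hL hyw (by simp [hAL, hQL])
    have h2 := h1.append (HasPathOn.singleton x') hwx (by simp [hx])
    have h3 := h2.append hQ₁ ha₁ (by simp [hd])
    refine (h3.append (HasPathOn.singleton y') hb₁ (by simp [hy, hd, hxy.symm])).congr ?_
    ext z
    simp only [Finset.mem_union, Finset.mem_singleton, Finset.mem_insert]
    tauto
  refine ⟨key, ?_⟩
  intro v hv hvA
  rcases Finset.mem_union.1 hv with hv | hv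
  · simp only [Finset.mem_union, not_or, Finset.mem_insert, Finset.mem_singleton] at hvA
    have hvL : v ∉ L := hvA.1.2
    -- The old chain absorbs `v`, which frees `Q` to close the new slot.
    have h1 := (h.2 v hv hvA.1.1.1).append hL hyw (by simp [hAL, hvL])
    have h2 := h1.append (HasPathOn.singleton x') hwx (by
      simp only [Finset.disjoint_singleton_right, Finset.mem_union, Finset.mem_insert]
      rintro ((rfl | h) | h)
      · exact hvA.2.1 rfl
      · exact hx.1.1 h
      · exact hx.2 h)
    have h3 := h2.append hQ hxa' (by
      simp only [Finset.disjoint_union_left, Finset.disjoint_insert_left,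
        Finset.disjoint_singleton_left]
      exact ⟨⟨⟨hvA.1.1.2, hAQ⟩, hQL.symm⟩, hx.1.2⟩)
    refine (h3.append (HasPathOn.singleton y') hby' ?_).congr ?_
    · simp only [Finset.disjoint_singleton_right, Finset.mem_union, Finset.mem_insert,
        Finset.mem_singleton]
      rintro ((((rfl | h) | h) | h) | h)
      · exact hvA.2.2 rfl
      · exact hy.1.1 h
      · exact hy.2 h
      · exact hxy h.symm
      · exact hy.1.2 h
    · ext z
      simp only [Finset.mem_union, Finset.mem_singleton, Finset.mem_insert]
      tauto
  · rw [Finset.mem_inter, mem_neighborFinset, mem_neighborFinset] at hv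
    refine (key v v {v} (HasPathOn.singleton v) hv.1 hv.2.symm (by simpa using hvA)).congr ?_
    ext z
    simp only [Finset.mem_union, Finset.mem_singleton, Finset.mem_insert]
    tauto

end SimpleGraph

/-! ### Greedy choice of disjoint sets -/

/-- Pairwise disjoint finite sets with prescribed properties can be chosen one by one. -/
theorem Finset.exists_pairwise_disjoint_of_extend {ι V : Type*} [Finite ι]
    (P : ι → Finset V → Prop)
    (h : ∀ (S : Finset ι) (i : ι) (A : ι → Finset V), i ∉ S → (∀ j ∈ S, P j (A j)) →
      (S : Set ι).PairwiseDisjoint A → ∃ X, P i X ∧ ∀ j ∈ S, Disjoint X (A j)) :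
    ∃ A : ι → Finset V, (∀ i, P i (A i)) ∧ Pairwise fun i j => Disjoint (A i) (A j) := by
  classical
  cases nonempty_fintype ι
  have key : ∀ S : Finset ι, ∃ A : ι → Finset V, (∀ i ∈ S, P i (A i)) ∧
      (S : Set ι).PairwiseDisjoint A := by
    intro S
    induction S using Finset.induction_on with
    | empty => exact ⟨fun _ => ∅, by simp, by simp⟩
    | insert i S hi ih =>
      obtain ⟨A, hA, hd⟩ := ih
      obtain ⟨X, hX, hXd⟩ := h S i A hi hA hd
      have hne : ∀ j ∈ S, j ≠ i := fun j hj hji => hi (hji ▸ hj)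
      refine ⟨Function.update A i X, ?_, ?_⟩
      · intro j hj
        rcases Finset.mem_insert.1 hj with rfl | hj
        · simpa using hX
        · rw [Function.update_of_ne (hne j hj)]
          exact hA j hj
      · rw [Finset.coe_insert, Set.pairwiseDisjoint_insert]
        refine ⟨?_, ?_⟩
        · intro j hj k hk hjk
          simp only [Function.onFun]
          rw [Function.update_of_ne (hne j hj), Function.update_of_ne (hne k hk)]
          exact hd hj hk hjk
        · intro j hj hij
          rw [Function.update_self, Function.update_of_ne (hne j hj)]
          exact hXd j hj
  obtain ⟨A, hA, hd⟩ := key Finset.univ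
  exact ⟨A, fun i => hA i (by simp), fun i j hij => hd (by simp) (by simp) hij⟩

/-- Pairwise disjoint small sets can be chosen one by one as long as few elements are used. -/
theorem Finset.exists_pairwise_disjoint_of_small {ι V : Type*} [Fintype ι] [DecidableEq V]
    (P : ι → Finset V → Prop) (U₀ : Finset V) (s K : ℕ)
    (h : ∀ (i : ι) (U : Finset V), U₀ ⊆ U → U.card ≤ K →
      ∃ X, P i X ∧ X.card ≤ s ∧ Disjoint X U)
    (hK : U₀.card + Fintype.card ι * s ≤ K) :
    ∃ A : ι → Finset V, (∀ i, P i (A i) ∧ (A i).card ≤ s ∧ Disjoint (A i) U₀) ∧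
      Pairwise fun i j => Disjoint (A i) (A j) := by
  refine Finset.exists_pairwise_disjoint_of_extend
    (fun i X => P i X ∧ X.card ≤ s ∧ Disjoint X U₀) ?_
  intro S i A hi hA hd
  obtain ⟨X, hX, hXs, hXU⟩ := h i (U₀ ∪ S.biUnion A) Finset.subset_union_left (by
    calc (U₀ ∪ S.biUnion A).card ≤ U₀.card + (S.biUnion A).card := Finset.card_union_le _ _
      _ ≤ U₀.card + S.card * s := by
        gcongr
        exact Finset.card_biUnion_le_card_mul _ _ _ fun j hj => (hA j hj).2.1
      _ ≤ U₀.card + Fintype.card ι * s := by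
        gcongr
        exact Finset.card_le_univ S
      _ ≤ K := hK)
  rw [Finset.disjoint_union_right, Finset.disjoint_biUnion_right] at hXU
  exact ⟨X, ⟨hX, hXs, hXU.1⟩, hXU.2⟩

/-! ### Edges and long paths in joined graphs -/

namespace SimpleGraph

variable {V : Type*} {G : SimpleGraph V}

/-- `X` and `Y` may overlap: the factor two pays for removing an `m`-subset of `X` from `Y`. -/
theorem IsJoined.exists_adj [DecidableEq V] {m : ℕ} (hJ : G.IsJoined m) {X Y : Finset V}
    (hX : m ≤ X.card) (hY : 2 * m ≤ Y.card) : ∃ x ∈ X, ∃ y ∈ Y, G.Adj x y := by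
  obtain ⟨X', hX', hXc⟩ := Finset.exists_subset_card_eq hX
  have h1 : m ≤ (Y \ X').card := by
    have := Finset.le_card_sdiff X' Y
    omega
  obtain ⟨Y', hY', hYc⟩ := Finset.exists_subset_card_eq h1
  obtain ⟨x, hx, y, hy, hxy⟩ := hJ X' Y' hXc hYc (by
    rw [Finset.disjoint_right]
    exact fun y hy => (Finset.mem_sdiff.1 (hY' hy)).2)
  exact ⟨x, hX' hx, y, (Finset.mem_sdiff.1 (hY' hy)).1, hxy⟩

theorem IsJoined.card_lt_of_not_adj {m : ℕ} (hJ : G.IsJoined m) {X Y : Finset V}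
    (hX : m ≤ X.card) (hd : Disjoint X Y) (h : ∀ x ∈ X, ∀ y ∈ Y, ¬ G.Adj x y) : Y.card < m := by
  by_contra! hcon
  obtain ⟨X', hX', hXc⟩ := Finset.exists_subset_card_eq hX
  obtain ⟨Y', hY', hYc⟩ := Finset.exists_subset_card_eq hcon
  obtain ⟨x, hx, y, hy, hxy⟩ := hJ X' Y' hXc hYc (hd.mono hX' hY')
  exact h x (hX' hx) y (hY' hy) hxy

theorem IsJoined.pos {m : ℕ} (hJ : G.IsJoined m) : 0 < m := by
  rcases Nat.eq_zero_or_pos m with rfl | h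
  · obtain ⟨a, ha, -⟩ := hJ ∅ ∅ rfl rfl (by simp)
    simp at ha
  · exact h

/-- This is the backtracking move of the depth-first search below. -/
theorem HasPathOn.erase_left [DecidableEq V] {a b : V} {S : Finset V} (h : G.HasPathOn a b S) :
    S.erase a = ∅ ∨ ∃ a' b', G.HasPathOn a' b' (S.erase a) := by
  obtain ⟨p, hp, hS⟩ := h
  cases p with
  | nil =>
    left
    ext x
    simp [← hS]
  | cons hadj q =>
    right
    rw [Walk.cons_isPath_iff] at hp
    refine ⟨_, _, q, hp.1, fun x => ?_⟩
    rw [Finset.mem_erase, ← hS, Walk.support_cons, List.mem_cons]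
    constructor
    · intro hx
      exact ⟨fun h => hp.2 (h ▸ hx), Or.inr hx⟩
    · rintro ⟨h1, h2⟩
      exact h2.resolve_left h1

/-- In an `m`-joined graph any set of `2 * m + l` vertices contains a path on `l` vertices. -/
theorem IsJoined.exists_path_in [DecidableEq V] {m : ℕ} (hJ : G.IsJoined m) (W : Finset V) (l : ℕ) (hl : 0 < l)
    (hW : l + 2 * m ≤ W.card) :
    ∃ a b P, G.HasPathOn a b P ∧ P ⊆ W ∧ P.card = l := by
  by_contra hno
  -- Depth-first search: `S` holds the finished vertices, `T` the unvisited ones, `P` the current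
  -- path. There is never an edge between `S` and `T`, and `2|T| + |P|` drops both when the path
  -- grows and when it backtracks. While |S| ≤ m and |P| < l, more than `m` vertices are unvisited.
  have key : ∀ k : ℕ, ∀ S T P : Finset V, S.card ≤ m → Disjoint S T → Disjoint P T →
      Disjoint S P → S ∪ T ∪ P = W → (∀ s ∈ S, ∀ t ∈ T, ¬ G.Adj s t) →
      (P = ∅ ∨ ∃ a b, G.HasPathOn a b P) → P.card < l → 2 * T.card + P.card = k → False := by
    intro k
    induction k using Nat.strong_induction_on with
    | _ k ih =>
    intro S T P hS hST hPT hSP hW' hadj hP hPl hk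
    have hcard : W.card = S.card + T.card + P.card := by
      rw [← hW', Finset.card_union_of_disjoint, Finset.card_union_of_disjoint hST]
      exact Finset.disjoint_union_left.2 ⟨hSP, hPT.symm⟩
    have hT : m < T.card := by omega
    have hext : ∀ P' t, t ∈ T → P' = insert t P → (∃ a b, G.HasPathOn a b P') → False := by
      intro P' t ht hP' ⟨a, b, hab⟩
      have htP : t ∉ P := Finset.disjoint_right.1 hPT ht
      have htS : t ∉ S := Finset.disjoint_right.1 hST ht
      have hc : P'.card = P.card + 1 := by rw [hP', Finset.card_insert_of_notMem htP]
      have hWeq : S ∪ T.erase t ∪ P' = W := by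
        rw [← hW', hP']
        ext v
        by_cases hv : v = t
        · simp [hv, ht]
        · simp [hv]
      rcases Nat.lt_or_ge P'.card l with h | h
      · refine ih (2 * (T.erase t).card + P'.card) ?_ S (T.erase t) P' hS
          (hST.mono_right (Finset.erase_subset _ _)) ?_ ?_ hWeq
          (fun s hs t' ht' => hadj s hs t' (Finset.mem_of_mem_erase ht')) (Or.inr ⟨a, b, hab⟩)
          h rfl
        · have := Finset.card_erase_add_one ht
          omega
        · rw [hP', Finset.disjoint_insert_left]
          exact ⟨by simp, hPT.mono_right (Finset.erase_subset _ _)⟩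
        · rw [hP', Finset.disjoint_insert_right]
          exact ⟨htS, hSP⟩
      · exact hno ⟨a, b, P', hab, by rw [← hWeq]; exact Finset.subset_union_right, by omega⟩
    rcases hP with rfl | ⟨a, b, hab⟩
    · obtain ⟨t, ht⟩ := Finset.card_pos.1 (by omega : 0 < T.card)
      exact hext {t} t ht (by simp) ⟨t, t, HasPathOn.singleton t⟩
    · by_cases ha : ∃ t ∈ T, G.Adj a t
      · obtain ⟨t, ht, hat⟩ := ha
        have htP : t ∉ P := Finset.disjoint_right.1 hPT ht
        refine hext (insert t P) t ht rfl ⟨t, b, ?_⟩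
        exact (HasPathOn.singleton t).append hab hat.symm (by simpa using htP)
      · push Not at ha
        -- The search cannot have to backtrack when |S| = m, as `S` would then have an edge into
        -- `T`.
        have hSm : S.card < m := by
          by_contra! hSm
          obtain ⟨T', hT', hTc⟩ := Finset.exists_subset_card_eq hT.le
          obtain ⟨s, hs, t, ht, hst⟩ := hJ S T' (by omega) hTc (hST.mono_right hT')
          exact hadj s hs t (hT' ht) hst
        have haP := hab.left_mem
        have haT : a ∉ T := Finset.disjoint_left.1 hPT haP
        have haS : a ∉ S := Finset.disjoint_right.1 hSP haP
        have hpath : P.erase a = ∅ ∨ ∃ a' b', G.HasPathOn a' b' (P.erase a) :=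
          hab.erase_left
        have hc := Finset.card_erase_add_one haP
        refine ih (2 * T.card + (P.erase a).card) (by omega) (insert a S) T (P.erase a) ?_ ?_ ?_ ?_
          ?_ ?_ hpath (by omega) rfl
        · rw [Finset.card_insert_of_notMem haS]
          omega
        · rw [Finset.disjoint_insert_left]
          exact ⟨haT, hST⟩
        · exact hPT.mono_left (Finset.erase_subset _ _)
        · rw [Finset.disjoint_insert_left]
          exact ⟨by simp, hSP.mono_right (Finset.erase_subset _ _)⟩
        · rw [← hW']
          ext v
          by_cases hv : v = a
          · simp [hv, haP]
          · simp [hv]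
        · intro s hs t ht
          rcases Finset.mem_insert.1 hs with rfl | hs
          · exact ha t ht
          · exact hadj s hs t ht
  exact key _ ∅ W ∅ (by simp) (by simp) (by simp) (by simp) (by simp) (by simp) (Or.inl rfl)
    (by simpa using hl) rfl

/-! ### Short connections and the construction of gadgets -/

variable [Fintype V] [DecidableEq V] [DecidableRel G.Adj]

/-- Outside `U` both neighbourhoods keep at least `2 * m` vertices, so some edge runs between them.
They may overlap, and `u = w` is allowed. -/
theorem IsJoined.exists_connector {m D : ℕ} (hJ : G.IsJoined m) (hD : ∀ v, D ≤ G.degree v)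
    (u w : V) (U : Finset V) (hU : U.card + 2 * m ≤ D) :
    ∃ z z' Z, G.HasPathOn z z' Z ∧ Z.card = 2 ∧ Disjoint Z U ∧ G.Adj u z ∧ G.Adj z' w := by
  have key : ∀ v, 2 * m ≤ (G.neighborFinset v \ U).card := by
    intro v
    have := Finset.le_card_sdiff U (G.neighborFinset v)
    have := hD v
    rw [card_neighborFinset_eq_degree] at *
    omega
  obtain ⟨x, hx, y, hy, hxy⟩ := hJ.exists_adj ((by omega : m ≤ 2 * m).trans (key u)) (key w)
  rw [Finset.mem_sdiff, mem_neighborFinset] at hx hy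
  exact ⟨x, y, {x, y}, HasPathOn.pair hxy, Finset.card_pair hxy.ne, by simp [hx.2, hy.2],
    hx.1, hy.1.symm⟩

/-- All but few of the vertices outside `U` have a common neighbour with `x` outside `U`. -/
theorem IsJoined.exists_many_common_neighbor {m D : ℕ} (hJ : G.IsJoined m)
    (hD : ∀ v, D ≤ G.degree v) (x : V) (U : Finset V) (hU : U.card + 2 * m ≤ D) :
    ∃ F : Finset V, (∀ f ∈ F, f ∉ U ∧ ∃ a, a ∉ U ∧ G.Adj x a ∧ G.Adj f a) ∧
      ∀ v, D ≤ (F.filter fun f => G.Adj v f).card + U.card + 2 * m := by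
  have hx1 : m ≤ (G.neighborFinset x \ U).card := by
    have h1 := Finset.le_card_sdiff U (G.neighborFinset x)
    have h2 := hD x
    rw [card_neighborFinset_eq_degree] at h1
    omega
  -- Fewer than `m` vertices outside `U ∪ X` see nothing of these `m` neighbours of `x`.
  obtain ⟨X, hXs, hXc⟩ := Finset.exists_subset_card_eq hx1
  obtain ⟨W, hW⟩ : ∃ W, W = Finset.univ \ (U ∪ X) := ⟨_, rfl⟩
  obtain ⟨Bad, hBad⟩ : ∃ Bad, Bad = W.filter fun w => ∀ x ∈ X, ¬ G.Adj x w := ⟨_, rfl⟩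
  have hBc : Bad.card < m := by
    rw [hBad]
    refine hJ.card_lt_of_not_adj hXc.ge ?_ fun x hx w hw => (Finset.mem_filter.1 hw).2 x hx
    rw [Finset.disjoint_right]
    intro y hy hyX
    simp [hW, hyX] at hy
  refine ⟨W \ Bad, ?_, ?_⟩
  · intro f hf
    obtain ⟨hfW, hfBad⟩ := Finset.mem_sdiff.1 hf
    refine ⟨fun h => ?_, ?_⟩
    · rw [hW] at hfW
      exact (Finset.mem_sdiff.1 hfW).2 (Finset.mem_union_left _ h)
    · have hfX : ∃ a ∈ X, G.Adj a f := by
        by_contra! hcon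
        exact hfBad (hBad ▸ Finset.mem_filter.2 ⟨hfW, hcon⟩)
      obtain ⟨a, ha, haf⟩ := hfX
      have haX := hXs ha
      rw [Finset.mem_sdiff, mem_neighborFinset] at haX
      exact ⟨a, haX.2, haX.1, haf.symm⟩
  · intro v
    have h1 : G.neighborFinset v ⊆
        ((W \ Bad).filter fun f => G.Adj v f) ∪ (U ∪ X ∪ Bad) := by
      intro y hy
      rw [mem_neighborFinset] at hy
      by_cases h2 : y ∈ U ∪ X ∪ Bad
      · exact Finset.mem_union_right _ h2
      · rw [Finset.mem_union, not_or] at h2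
        refine Finset.mem_union_left _ (Finset.mem_filter.2 ⟨?_, hy⟩)
        rw [Finset.mem_sdiff, hW]
        exact ⟨Finset.mem_sdiff.2 ⟨Finset.mem_univ _, h2.1⟩, h2.2⟩
    have h2 := Finset.card_le_card h1
    rw [card_neighborFinset_eq_degree] at h2
    have h3 := Finset.card_union_le ((W \ Bad).filter fun f => G.Adj v f) (U ∪ X ∪ Bad)
    have h4 := Finset.card_union_le (U ∪ X) Bad
    have h5 := Finset.card_union_le U X
    have h6 := hD v
    omega

/-- For every vertex `x` there is a fresh vertex `x'` that has a fresh common neighbour with `x`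
and is adjacent to a positive proportion of a prescribed set `B`. -/
theorem IsJoined.exists_common_neighbor {m D : ℕ} (hJ : G.IsJoined m)
    (hD : ∀ v, D ≤ G.degree v) {θ : ℝ} (hθ : 0 < θ) (x : V) (U B : Finset V)
    (hU : θ * Fintype.card V + U.card + 2 * m ≤ D) :
    ∃ x' a, x' ∉ U ∧ a ∉ U ∧ G.Adj x a ∧ G.Adj x' a ∧
      θ * B.card ≤ (B ∩ G.neighborFinset x').card := by
  have hUD : U.card + 2 * m ≤ D := by
    have : (0 : ℝ) ≤ θ * Fintype.card V := by positivity
    exact_mod_cast (by linarith : (U.card : ℝ) + 2 * m ≤ D)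
  obtain ⟨F, hF, hFD⟩ := hJ.exists_many_common_neighbor hD x U hUD
  have hFdeg : ∀ v, θ * Fintype.card V ≤ ((F.filter fun f => G.Adj v f).card : ℝ) := by
    intro v
    have h8 : (D : ℝ) ≤ (F.filter fun f => G.Adj v f).card + U.card + 2 * m := by
      exact_mod_cast hFD v
    linarith
  have hn : 0 < Fintype.card V := Fintype.card_pos_iff.2 ⟨x⟩
  have hFne : F.Nonempty := by
    have h1 := hFdeg x
    have h2 : (0 : ℝ) < ((F.filter fun f => G.Adj x f).card : ℝ) :=
      lt_of_lt_of_le (by positivity) h1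
    have h3 : 0 < (F.filter fun f => G.Adj x f).card := by exact_mod_cast h2
    exact (Finset.card_pos.1 h3).mono (Finset.filter_subset _ _)
  -- Edges between `B` and `F` are counted twice: every vertex of `B` sends at least θn edges to
  -- `F`, and |F| ≤ n, so some `f` in `F` has at least θ|B| neighbours in `B`.
  have hdc : ∑ f ∈ F, (B ∩ G.neighborFinset f).card
      = ∑ v ∈ B, (F.filter fun f => G.Adj v f).card := by
    have h1 := Finset.sum_card_bipartiteAbove_eq_sum_card_bipartiteBelow
      (s := B) (t := F) (r := fun v f => G.Adj v f)
    rw [show ∑ v ∈ B, (F.filter fun f => G.Adj v f).card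
      = ∑ v ∈ B, (Finset.bipartiteAbove (fun v f => G.Adj v f) F v).card from rfl, h1]
    refine Finset.sum_congr rfl fun f _ => ?_
    congr 1
    ext v
    simp [Finset.bipartiteBelow, G.adj_comm]
  have hsum : ∑ f ∈ F, θ * (B.card : ℝ) ≤ ∑ f ∈ F, ((B ∩ G.neighborFinset f).card : ℝ) := by
    rw [← Nat.cast_sum, hdc, Nat.cast_sum]
    calc ∑ f ∈ F, θ * (B.card : ℝ) = F.card * (θ * B.card) := by
          rw [Finset.sum_const, nsmul_eq_mul]
      _ ≤ Fintype.card V * (θ * B.card) := by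
        gcongr
        exact Finset.card_le_univ F
      _ = ∑ v ∈ B, θ * Fintype.card V := by
        rw [Finset.sum_const, nsmul_eq_mul]
        ring
      _ ≤ _ := Finset.sum_le_sum fun v _ => hFdeg v
  obtain ⟨f, hf, hfB⟩ := Finset.exists_le_of_sum_le hFne hsum
  obtain ⟨hfU, a, ha, hxa, hfa⟩ := hF f hf
  exact ⟨f, a, hfU, ha, hxa, hfa, hfB⟩

/-- Each round adds one slot and at most 8 vertices: two sides `x'`, `y'`, a filler of four vertices
and a connector of two. It multiplies the number of vertices not yet insertable by at most 1 - θ².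
-/
theorem IsJoined.exists_slotChain [Nonempty V] {m D : ℕ} (hJ : G.IsJoined m)
    (hD : ∀ v, D ≤ G.degree v) {θ : ℝ} (hθ : 0 < θ) (hθ1 : θ ≤ 1) (d : ℕ) (U : Finset V)
    (hU : θ * Fintype.card V + U.card + 2 * m + 8 * d + 2 ≤ D) :
    ∃ A C e x y, G.IsSlotChain A C e x y ∧ Disjoint A U ∧ A.card ≤ 2 + 8 * d ∧
      ((Finset.univ \ C).card : ℝ) ≤ (1 - θ ^ 2) ^ d * Fintype.card V := by
  have hUD : U.card + 2 * m + 8 * d + 2 ≤ D := by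
    have : (0 : ℝ) ≤ θ * Fintype.card V := by positivity
    exact_mod_cast (by linarith : (U.card : ℝ) + 2 * m + 8 * d + 2 ≤ D)
  induction d with
  | zero =>
    obtain ⟨v⟩ := ‹Nonempty V›
    have h1 : 1 < (G.neighborFinset v \ U).card := by
      have := Finset.le_card_sdiff U (G.neighborFinset v)
      have := hD v
      rw [card_neighborFinset_eq_degree] at *
      omega
    obtain ⟨x, hx, y, hy, hxy⟩ := Finset.one_lt_card.1 h1
    rw [Finset.mem_sdiff] at hx hy
    refine ⟨{x, y}, ∅, x, x, y, isSlotChain_pair hxy, by simp [hx.2, hy.2], ?_, by simp⟩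
    rw [Finset.card_pair hxy]
  | succ d ih =>
    push_cast at hU
    obtain ⟨A, C, e, x, y, hch, hAU, hAc, hC⟩ := ih (by linarith) (by omega)
    have hAc' : (A.card : ℝ) ≤ 2 + 8 * d := by exact_mod_cast hAc
    have hcU : ∀ T : Finset V, T.card ≤ 6 → (U ∪ A ∪ T).card ≤ U.card + 8 * d + 8 := by
      intro T hT
      have h1 := Finset.card_union_le (U ∪ A) T
      have h2 := Finset.card_union_le U A
      omega
    have hcR : ∀ T : Finset V, T.card ≤ 6 →
        θ * Fintype.card V + (U ∪ A ∪ T).card + 2 * m ≤ D := by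
      intro T hT
      have h1 : ((U ∪ A ∪ T).card : ℝ) ≤ U.card + 8 * d + 8 := by exact_mod_cast hcU T hT
      linarith
    -- `x'` sees a proportion θ of the uncovered vertices. Next, `y'` is chosen to see a proportion
    -- θ of those seen by `x'`.
    obtain ⟨x', a, hx', ha, hxa, hxa', hcov1⟩ := hJ.exists_common_neighbor hD hθ x (U ∪ A ∪ ∅)
      (Finset.univ \ C) (hcR ∅ (by simp))
    obtain ⟨y', b, hy', hb, hyb, hyb', hcov2⟩ := hJ.exists_common_neighbor hD hθ y
      (U ∪ A ∪ {x', a}) ((Finset.univ \ C) ∩ G.neighborFinset x')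
      (hcR _ (Finset.card_le_two.trans (by norm_num)))
    obtain ⟨z, z', Z, hZ, hZc, hZU, haz, hzb⟩ := hJ.exists_connector hD a b
      (U ∪ A ∪ {x', a, y', b}) (by
        have := hcU {x', a, y', b} (Finset.card_le_four.trans (by norm_num))
        omega)
    obtain ⟨w, w', L, hL, hLc, hLU, hyw, hwx⟩ := hJ.exists_connector hD y x'
      (U ∪ A ∪ ({x', a, y', b} ∪ Z)) (by
        have := hcU ({x', a, y', b} ∪ Z) ((Finset.card_union_le _ _).trans (by
          rw [hZc]
          have : ({x', a, y', b} : Finset V).card ≤ 4 := Finset.card_le_four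
          omega))
        omega)
    simp only [Finset.mem_union, not_or, Finset.mem_insert, Finset.mem_singleton,
      Finset.notMem_empty, not_false_eq_true, and_true, Finset.disjoint_union_right,
      Finset.disjoint_insert_right, Finset.disjoint_singleton_right] at hx' ha hy' hb hZU hLU
    have hax' : a ≠ x' := hxa'.ne'
    have hby' : b ≠ y' := hyb'.ne'
    have hQ : G.HasPathOn a b ({a} ∪ Z ∪ {b}) :=
      ((HasPathOn.singleton a).append hZ haz (by simp [hZU])).append (HasPathOn.singleton b) hzb
        (by simp [hZU, hb.2.2])
    refine ⟨A ∪ ({a} ∪ Z ∪ {b}) ∪ L ∪ {x', y'},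
      C ∪ (G.neighborFinset x' ∩ G.neighborFinset y'), e, x', y',
      hch.extend hQ hL hxa hyb.symm hxa' hyb'.symm hyw hwx (fun h => hy'.2.1 h.symm) ?_ ?_ ?_ ?_ ?_,
      ?_, ?_, ?_⟩
    · simp [ha, hb, hZU.1.2.symm]
    · exact hLU.1.2.symm
    · simp [hLU, hLU.2.2.symm]
    · simp [hx', hZU, hax'.symm, hLU, Ne.symm hb.2.1]
    · simp [hy', hZU, hby'.symm, hLU]
    · simp [hAU, ha, hb, hZU, hLU, hx', hy']
    · have h1 := Finset.card_union_le (A ∪ ({a} ∪ Z ∪ {b}) ∪ L) {x', y'}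
      have h2 := Finset.card_union_le (A ∪ ({a} ∪ Z ∪ {b})) L
      have h3 := Finset.card_union_le A ({a} ∪ Z ∪ {b})
      have h4 := Finset.card_union_le ({a} ∪ Z) {b}
      have h5 := Finset.card_union_le {a} Z
      have h6 : ({x', y'} : Finset V).card ≤ 2 := Finset.card_le_two
      simp only [Finset.card_singleton] at h4 h5
      omega
    · have h1 : Finset.univ \ (C ∪ (G.neighborFinset x' ∩ G.neighborFinset y'))
          = (Finset.univ \ C) \ ((Finset.univ \ C) ∩ G.neighborFinset x' ∩ G.neighborFinset y') := by
        ext v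
        simp only [Finset.mem_sdiff, Finset.mem_univ, true_and, Finset.mem_union,
          Finset.mem_inter]
        tauto
      have h2 := Finset.card_sdiff_add_card_eq_card
        (s := (Finset.univ \ C) ∩ G.neighborFinset x' ∩ G.neighborFinset y')
        (t := Finset.univ \ C)
        (Finset.inter_subset_left.trans Finset.inter_subset_left)
      rw [← h1] at h2
      have h3 : ((Finset.univ \ (C ∪ (G.neighborFinset x' ∩ G.neighborFinset y'))).card : ℝ)
          + (((Finset.univ \ C) ∩ G.neighborFinset x' ∩ G.neighborFinset y').card : ℝ)
          = ((Finset.univ \ C).card : ℝ) := by exact_mod_cast h2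
      have h4 : θ * (θ * ((Finset.univ \ C).card : ℝ)) ≤
          θ * (((Finset.univ \ C) ∩ G.neighborFinset x').card : ℝ) := by gcongr
      have h5 : 0 ≤ 1 - θ ^ 2 := by nlinarith
      calc _ ≤ (1 - θ ^ 2) * ((Finset.univ \ C).card : ℝ) := by linarith
        _ ≤ (1 - θ ^ 2) * ((1 - θ ^ 2) ^ d * Fintype.card V) := by gcongr
        _ = _ := by ring

end SimpleGraph

/-! ### Linking absorbers into one path -/

namespace SimpleGraph

variable {V : Type*} {G : SimpleGraph V} [Fintype V] [DecidableEq V] [DecidableRel G.Adj]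

/-- Disjoint absorbers can be linked, one after the other, by connectors of two vertices. -/
theorem IsJoined.exists_absorbs_link {ι κ : Type*} [DecidableEq ι] {m D : ℕ}
    (hJ : G.IsJoined m) (hD : ∀ v, D ≤ G.degree v) {C : ι → Finset V} {e f : κ → V}
    {A : κ → Finset V} {T : κ → Finset ι} {S : Finset κ}
    (hA : ∀ j ∈ S, G.Absorbs C (e j) (f j) (A j) (T j))
    (hAd : (S : Set κ).PairwiseDisjoint A) (hTd : (S : Set κ).PairwiseDisjoint T)
    {p q : V} {X₀ : Finset V} {T₀ : Finset ι} (h₀ : G.Absorbs C p q X₀ T₀)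
    (hX₀ : ∀ j ∈ S, Disjoint X₀ (A j)) (hT₀ : ∀ j ∈ S, Disjoint T₀ (T j))
    {U : Finset V} (hX₀U : X₀ ⊆ U) (hAU : ∀ j ∈ S, A j ⊆ U)
    (hU : U.card + 2 * S.card + 2 * m ≤ D) :
    ∃ q' Y, G.Absorbs C p q' (X₀ ∪ S.biUnion A ∪ Y) (T₀ ∪ S.biUnion T) ∧
      Y.card ≤ 2 * S.card ∧ Disjoint Y U := by
  classical
  induction S using Finset.induction_on with
  | empty => exact ⟨q, ∅, by simpa using h₀, by simp, by simp⟩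
  | insert i S hi ih =>
    rw [Finset.card_insert_of_notMem hi] at hU
    rw [Finset.coe_insert, Set.pairwiseDisjoint_insert_of_notMem (by simpa using hi)] at hAd hTd
    simp only [Finset.forall_mem_insert] at hA hX₀ hT₀ hAU
    obtain ⟨q', Y, hY, hYc, hYU⟩ := ih hA.2 hAd.1 hTd.1 hX₀.2 hT₀.2 hAU.2 (by omega)
    obtain ⟨z, z', Z, hZ, hZc, hZU, hqz, hze⟩ := hJ.exists_connector hD q' (e i) (U ∪ Y) (by
      have := Finset.card_union_le U Y
      omega)
    rw [Finset.disjoint_union_right] at hZU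
    have hSU : S.biUnion A ⊆ U := Finset.biUnion_subset.2 hAU.2
    have h1 := hY.append (T' := ∅) hZ.absorbs hqz (by
      rw [Finset.disjoint_union_left, Finset.disjoint_union_left]
      exact ⟨⟨(hZU.1.mono_right hX₀U).symm, (hZU.1.mono_right hSU).symm⟩, hZU.2.symm⟩) (by simp)
    have h2 := h1.append hA.1 hze (by
      simp only [Finset.disjoint_union_left, Finset.disjoint_biUnion_left]
      exact ⟨⟨⟨hX₀.1, fun j hj => (hAd.2 j hj).symm⟩, hYU.mono_right hAU.1⟩,
        hZU.1.mono_right hAU.1⟩) (by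
      simp only [Finset.disjoint_union_left, Finset.disjoint_biUnion_left]
      exact ⟨⟨hT₀.1, fun j hj => (hTd.2 j hj).symm⟩, by simp⟩)
    refine ⟨f i, Y ∪ Z, ?_, ?_, ?_⟩
    · convert h2 using 1
      · ext x
        simp only [Finset.mem_union, Finset.biUnion_insert]
        tauto
      · ext x
        simp only [Finset.mem_union, Finset.biUnion_insert, Finset.notMem_empty]
        tauto
    · have := Finset.card_union_le Y Z
      rw [Finset.card_insert_of_notMem hi]
      omega
    · rw [Finset.disjoint_union_left]
      exact ⟨hYU, hZU.1⟩

/-- A family of disjoint absorbers and a set `Z` of further vertices lie on a common path that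
starts next to `u` and ends in `a`. -/
theorem IsJoined.exists_absorbs_from_to {ι : Type*} [DecidableEq ι] {m D : ℕ}
    (hJ : G.IsJoined m) (hD : ∀ v, D ≤ G.degree v) {C : ι → Finset V} {e f : ι → V}
    {A : ι → Finset V} {S : Finset ι} {Z U : Finset V} {u a : V}
    (hA : ∀ j ∈ S, G.Absorbs C (e j) (f j) (A j) {j})
    (hAd : (S : Set ι).PairwiseDisjoint A) (hZA : ∀ j ∈ S, Disjoint Z (A j))
    (haA : ∀ j ∈ S, a ∉ A j) (haZ : a ∉ Z) (hAU : ∀ j ∈ S, A j ⊆ U) (hZU : Z ⊆ U)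
    (haU : a ∈ U) (hU : U.card + 2 * (S.card + Z.card) + 3 + 2 * m ≤ D) :
    ∃ p Y, G.Adj u p ∧ G.Absorbs C p a (Y ∪ S.biUnion A ∪ Z ∪ {a}) S ∧
      Y.card ≤ 2 * (S.card + Z.card) + 3 ∧ Disjoint Y U := by
  obtain ⟨p, hp⟩ : (G.neighborFinset u \ U).Nonempty := by
    rw [← Finset.card_pos]
    have h1 := Finset.le_card_sdiff U (G.neighborFinset u)
    have h2 := hD u
    rw [card_neighborFinset_eq_degree] at h1
    omega
  rw [Finset.mem_sdiff, mem_neighborFinset] at hp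
  have hpA : ∀ j ∈ S, p ∉ A j := fun j hj h => hp.2 (hAU j hj h)
  have hpZ : p ∉ Z := fun h => hp.2 (hZU h)
  have hpa : p ≠ a := fun h => hp.2 (h ▸ haU)
  have hSU : S.biUnion A ⊆ U := Finset.biUnion_subset.2 hAU
  obtain ⟨q₁, Y₁, h₁, hY₁c, hY₁U⟩ := hJ.exists_absorbs_link hD (T := fun j => {j}) (S := S)
    (T₀ := ∅) (U := insert p U) hA hAd
    (fun i _ j _ hij => by simpa [Function.onFun] using hij)
    (HasPathOn.singleton p).absorbs (fun j hj => by simpa using hpA j hj) (by simp) (by simp)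
    (fun j hj => (hAU j hj).trans (Finset.subset_insert _ _)) (by
      have := Finset.card_insert_le p U
      omega)
  rw [Finset.disjoint_insert_right] at hY₁U
  -- The vertices of `Z` are linked as one-vertex absorbers that absorb nothing.
  obtain ⟨q₂, Y₂, h₂, hY₂c, hY₂U⟩ := hJ.exists_absorbs_link hD (κ := V) (e := id) (f := id)
    (A := fun z => {z}) (T := fun j => ∅) (S := Z) (U := insert p U ∪ Y₁)
    (fun z _ => (HasPathOn.singleton z).absorbs)
    (fun i _ j _ hij => by simpa [Function.onFun] using hij)
    (fun i _ j _ hij => by simp [Function.onFun]) h₁ (by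
      intro z hz
      simp only [Finset.disjoint_singleton_right, Finset.mem_union, Finset.mem_singleton,
        Finset.mem_biUnion, not_or, not_exists, not_and]
      refine ⟨⟨fun h => hpZ (h ▸ hz), fun j hj h => ?_⟩, fun h => ?_⟩
      · exact Finset.disjoint_left.1 (hZA j hj) hz h
      · exact Finset.disjoint_left.1 hY₁U.2 h (hZU hz)) (by simp) (by
      intro x hx
      simp only [Finset.mem_union, Finset.mem_singleton, Finset.mem_insert] at hx ⊢
      rcases hx with (hx | hx) | hx
      · exact Or.inl (Or.inl hx)
      · exact Or.inl (Or.inr (hSU hx))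
      · exact Or.inr hx) (by
      intro z hz
      have := hZU hz
      simp [this]) (by
      have := Finset.card_insert_le p U
      have := Finset.card_union_le (insert p U) Y₁
      omega)
  rw [Finset.disjoint_union_right, Finset.disjoint_insert_right] at hY₂U
  obtain ⟨z, z', W, hW, hWc, hWU, hqz, hza⟩ := hJ.exists_connector hD q₂ a
    (insert p U ∪ Y₁ ∪ Y₂) (by
      have := Finset.card_insert_le p U
      have := Finset.card_union_le (insert p U) Y₁
      have := Finset.card_union_le (insert p U ∪ Y₁) Y₂
      omega)
  simp only [Finset.disjoint_union_right, Finset.disjoint_insert_right] at hWU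
  have haY₁ : a ∉ Y₁ := fun h => Finset.disjoint_left.1 hY₁U.2 h haU
  have haY₂ : a ∉ Y₂ := fun h => Finset.disjoint_left.1 hY₂U.1.2 h haU
  have haW : a ∉ W := fun h => Finset.disjoint_left.1 hWU.1.1.2 h haU
  have h₃ := (h₂.append (T' := ∅) hW.absorbs hqz (by
    simp only [Finset.disjoint_union_left, Finset.disjoint_singleton_left]
    refine ⟨⟨⟨⟨hWU.1.1.1, (hWU.1.1.2.mono_right hSU).symm⟩, hWU.1.2.symm⟩, ?_⟩, hWU.2.symm⟩
    rw [Finset.biUnion_singleton_eq_self]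
    exact (hWU.1.1.2.mono_right hZU).symm) (by simp)).append (T' := ∅)
    (HasPathOn.singleton a).absorbs hza (by
      rw [Finset.biUnion_singleton_eq_self]
      simp only [Finset.disjoint_singleton_right, Finset.mem_union, Finset.mem_singleton,
        Finset.mem_biUnion, not_or, not_exists, not_and]
      exact ⟨⟨⟨⟨⟨hpa.symm, haA⟩, haY₁⟩, haZ⟩, haY₂⟩, haW⟩) (by simp)
  rw [Finset.biUnion_singleton_eq_self] at h₃
  refine ⟨p, {p} ∪ Y₁ ∪ Y₂ ∪ W, hp.1, ?_, ?_, ?_⟩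
  · convert h₃ using 1
    · ext x
      simp only [Finset.mem_union]
      tauto
    · ext x
      simp
  · have k1 := Finset.card_union_le ({p} ∪ Y₁ ∪ Y₂) W
    have k2 := Finset.card_union_le ({p} ∪ Y₁) Y₂
    have k3 := Finset.card_union_le {p} Y₁
    rw [Finset.card_singleton] at k3
    omega
  · simp only [Finset.disjoint_union_left, Finset.disjoint_singleton_left]
    exact ⟨⟨⟨hp.2, hY₁U.2⟩, hY₂U.1.2⟩, hWU.1.1.2⟩

/-! ### The reservoir -/

/-- A small set `R` in which many vertices have a fair share of neighbours. -/
theorem exists_reservoir {D b r g τ : ℕ} (hD : ∀ v, D ≤ G.degree v)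
    (hbr : Fintype.card V ≤ b * r)
    (hlt : b * (g * r + Fintype.card V * τ) < Fintype.card V * D) :
    ∃ R : Finset V, R.card ≤ r ∧
      g ≤ (Finset.univ.filter fun v => τ ≤ (G.neighborFinset v ∩ R).card).card := by
  -- The embedding cuts `V` into `b` classes of at most `r` vertices; one of them serves as `R`. If
  -- all failed, each class would receive at most `g * r + n * τ` of the degree sum, which is too
  -- little in total.
  obtain ⟨φ⟩ : Nonempty (V ↪ Fin b × Fin r) :=
    Function.Embedding.nonempty_of_card_le (by simpa using hbr)
  obtain ⟨R, hR⟩ : ∃ R : Fin b → Finset V,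
      R = fun k => Finset.univ.filter fun v => (φ v).1 = k := ⟨_, rfl⟩
  have hRc : ∀ k, (R k).card ≤ r := by
    intro k
    have h1 : (R k).card ≤ (Finset.univ : Finset (Fin r)).card := by
      refine Finset.card_le_card_of_injOn (fun v => (φ v).2) (by simp) ?_
      intro v hv w hw hvw
      simp only [hR, Finset.coe_filter, Finset.mem_univ, true_and, Set.mem_ofPred_eq] at hv hw
      exact φ.injective (Prod.ext (hv.trans hw.symm) hvw)
    simpa using h1
  by_contra! hcon
  have h1 : ∀ v, D ≤ ∑ k, (G.neighborFinset v ∩ R k).card := by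
    intro v
    have h2 : (G.neighborFinset v).card = ∑ k, (G.neighborFinset v ∩ R k).card := by
      rw [Finset.card_eq_sum_card_fiberwise (f := fun v => (φ v).1) (t := Finset.univ) (by simp)]
      refine Finset.sum_congr rfl fun k _ => ?_
      congr 1
      ext x
      simp [hR]
    rw [← h2, card_neighborFinset_eq_degree]
    exact hD v
  have h2 : Fintype.card V * D ≤ ∑ v, ∑ k, (G.neighborFinset v ∩ R k).card := by
    have h3 := Finset.sum_le_sum fun v (_ : v ∈ (Finset.univ : Finset V)) => h1 v
    simpa using h3
  rw [Finset.sum_comm] at h2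
  have h3 : ∀ k, ∑ v, (G.neighborFinset v ∩ R k).card ≤ g * r + Fintype.card V * τ := by
    intro k
    rw [← Finset.sum_filter_add_sum_filter_not Finset.univ
      (fun v => τ ≤ (G.neighborFinset v ∩ R k).card)]
    refine Nat.add_le_add ?_ ?_
    · refine (Finset.sum_le_card_nsmul _ _ r fun v _ => ?_).trans ?_
      · exact (Finset.card_le_card Finset.inter_subset_right).trans (hRc k)
      · rw [smul_eq_mul]
        exact Nat.mul_le_mul_right _ (hcon (R k) (hRc k)).le
    · refine (Finset.sum_le_card_nsmul _ _ τ fun v hv => ?_).trans ?_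
      · exact (not_le.1 (Finset.mem_filter.1 hv).2).le
      · rw [smul_eq_mul]
        exact Nat.mul_le_mul_right _ (Finset.card_le_univ _)
  have h4 := Finset.sum_le_sum fun k (_ : k ∈ (Finset.univ : Finset (Fin b))) => h3 k
  rw [Finset.sum_const, Finset.card_univ, Fintype.card_fin, smul_eq_mul] at h4
  omega

end SimpleGraph

/-! ### Hall's theorem for sets that miss few elements -/

/-- If every set `C t` misses few elements, few elements are missed by many of the sets. -/
theorem Finset.card_filter_missed_le {ι V : Type*} [Fintype ι] [Nonempty ι] [Fintype V]
    [DecidableEq V] {C : ι → Finset V} {h : ℕ} (hC : ∀ t, (Finset.univ \ C t).card ≤ h) :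
    (Finset.univ.filter fun v =>
      Fintype.card ι < 2 * (Finset.univ.filter fun t => v ∉ C t).card).card ≤ 2 * h := by
  have h1 : ∑ v : V, (Finset.univ.filter fun t => v ∉ C t).card
      = ∑ t, (Finset.univ \ C t).card := by
    have h2 := Finset.sum_card_bipartiteAbove_eq_sum_card_bipartiteBelow
      (s := (Finset.univ : Finset V)) (t := (Finset.univ : Finset ι)) (r := fun v t => v ∉ C t)
    unfold Finset.bipartiteAbove at h2
    rw [h2]
    refine Finset.sum_congr rfl fun t _ => ?_
    congr 1
    ext v
    simp [Finset.bipartiteBelow]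
  have h2 : ∑ t, (Finset.univ \ C t).card ≤ Fintype.card ι * h := by
    have h3 := Finset.sum_le_sum fun t (_ : t ∈ (Finset.univ : Finset ι)) => hC t
    simpa using h3
  set Z := Finset.univ.filter fun v =>
      Fintype.card ι < 2 * (Finset.univ.filter fun t => v ∉ C t).card with hZ
  have h3 : Z.card * Fintype.card ι ≤ ∑ v ∈ Z, 2 * (Finset.univ.filter fun t => v ∉ C t).card := by
    rw [← smul_eq_mul]
    exact Finset.card_nsmul_le_sum _ _ _ fun v hv => (Finset.mem_filter.1 hv).2.le
  have h4 : ∑ v ∈ Z, 2 * (Finset.univ.filter fun t => v ∉ C t).card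
      ≤ 2 * (Fintype.card ι * h) := by
    rw [← Finset.mul_sum]
    refine Nat.mul_le_mul_left _ ((Finset.sum_le_univ_sum_of_nonneg (by simp)).trans ?_)
    rw [h1]
    exact h2
  have h5 : Fintype.card ι * Z.card ≤ Fintype.card ι * (2 * h) := by nlinarith
  exact Nat.le_of_mul_le_mul_left h5 Fintype.card_pos

/-- A system of distinct representatives covering `L` exactly, for sets which miss few
elements. -/
theorem Finset.exists_transversal {ι V : Type*} [Fintype ι] [Fintype V] [DecidableEq V]
    {C : ι → Finset V} {L : Finset V} (hL : L.card = Fintype.card ι)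
    (hC : ∀ t, 2 * (Finset.univ \ C t).card ≤ Fintype.card ι)
    (hv : ∀ v ∈ L, 2 * (Finset.univ.filter fun t => v ∉ C t).card ≤ Fintype.card ι) :
    ∃ v : ι → V, Function.Injective v ∧ (∀ t, v t ∈ C t) ∧ Finset.univ.image v = L := by
  obtain ⟨v, hvi, hvC⟩ := (Finset.all_card_le_biUnion_card_iff_exists_injective
    fun t => C t ∩ L).1 (by
      intro S
      rcases S.eq_empty_or_nonempty with rfl | ⟨t, ht⟩
      · simp
      -- Up to half of the indices, a single set already contains half of `L`; beyond that, every
      -- element of `L` lies in one of the sets.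
      by_cases hS : 2 * S.card ≤ Fintype.card ι
      · have h1 : (C t ∩ L) ⊆ S.biUnion fun t => C t ∩ L :=
          Finset.subset_biUnion_of_mem (fun t => C t ∩ L) ht
        have h2 : L ⊆ (C t ∩ L) ∪ (Finset.univ \ C t) := by
          intro x hx
          by_cases hx' : x ∈ C t <;> simp [hx, hx']
        have h3 := Finset.card_le_card h1
        have h4 := (Finset.card_le_card h2).trans (Finset.card_union_le _ _)
        have h5 := hC t
        omega
      · have h1 : L ⊆ S.biUnion fun t => C t ∩ L := by
          intro x hx
          by_contra hcon
          have h2 : S ⊆ Finset.univ.filter fun t => x ∉ C t := by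
            intro s hs
            rw [Finset.mem_filter]
            exact ⟨Finset.mem_univ _, fun hxs => hcon (Finset.mem_biUnion.2
              ⟨s, hs, Finset.mem_inter.2 ⟨hxs, hx⟩⟩)⟩
          have h3 := Finset.card_le_card h2
          have h4 := hv x hx
          omega
        have h2 := Finset.card_le_card h1
        have h3 := Finset.card_le_univ S
        omega)
  refine ⟨v, hvi, fun t => (Finset.mem_inter.1 (hvC t)).1, ?_⟩
  refine Finset.eq_of_subset_of_card_le ?_ ?_
  · intro x hx
    obtain ⟨t, -, rfl⟩ := Finset.mem_image.1 hx
    exact (Finset.mem_inter.1 (hvC t)).2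
  · rw [Finset.card_image_of_injective _ hvi, hL, Finset.card_univ]

/-! ### The absorbing paths -/

namespace SimpleGraph

variable {V : Type*} {G : SimpleGraph V}

theorem IsSlotChain.absorbs [DecidableEq V] {ι : Type*} {C : ι → Finset V} {t : ι}
    {A : Finset V} {e x y : V} (h : G.IsSlotChain A (C t) e x y) : G.Absorbs C e y A {t} := by
  intro v _ hC hA
  refine (h.2 (v t) (hC t (by simp)) (hA t (by simp))).congr ?_
  ext z
  simp

variable [Fintype V] [DecidableEq V] [DecidableRel G.Adj]

/-- Paths `E i` which start next to `u i`, end in vertices with many neighbours in `R`, and can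
together absorb any set of the right size disjoint from them. -/
theorem IsJoined.exists_absorbing_paths [Nonempty V] {I : Type*} [Fintype I] [Nonempty I]
    [DecidableEq I] {m D k d h τ : ℕ} {θ : ℝ} (hJ : G.IsJoined m) (hD : ∀ v, D ≤ G.degree v)
    (hθ : 0 < θ) (hθ1 : θ ≤ 1) (B R : Finset V) (u : I → V) (hk : 0 < k)
    (hgood : R.card + B.card + Fintype.card I ≤
      (Finset.univ.filter fun v => τ ≤ (G.neighborFinset v ∩ R).card).card)
    (hcov : (1 - θ ^ 2) ^ d * Fintype.card V ≤ h)
    (hh : 2 * h ≤ Fintype.card I * k)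
    (hbud : θ * Fintype.card V + R.card + B.card + 4 * Fintype.card I
      + (Fintype.card I * k : ℕ) * (16 * d + 16) + 2 * m ≤ D) :
    ∃ (C : I × Fin k → Finset V) (E : I → Finset V) (p a : I → V),
      (∀ t, (Finset.univ \ C t).card ≤ h) ∧ (∀ i, G.Adj (u i) (p i)) ∧
      (∀ i, G.Absorbs C (p i) (a i) (E i) ({i} ×ˢ Finset.univ)) ∧
      (∀ i, (E i).card ≤ k * (8 * d + 7) + 4) ∧ (∀ i, Disjoint (E i) B) ∧
      (Pairwise fun i j => Disjoint (E i) (E j)) ∧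
      (∀ i, τ ≤ (G.neighborFinset (a i) ∩ R).card) ∧
      (R ∩ Finset.univ.biUnion E).card ≤ 2 * h ∧
      ∀ v, v ∉ B → (∀ i, v ∉ E i) →
        2 * (Finset.univ.filter fun t => v ∉ C t).card ≤ Fintype.card (I × Fin k) := by
  obtain ⟨M, hM⟩ : ∃ M, M = Fintype.card I * k := ⟨_, rfl⟩
  have hι : Fintype.card (I × Fin k) = M := by simp [hM]
  have hI : 0 < Fintype.card I := Fintype.card_pos
  have hkM : k ≤ M := hM ▸ Nat.le_mul_of_pos_left k hI
  have : Nonempty (I × Fin k) := ⟨⟨Classical.arbitrary I, ⟨0, hk⟩⟩⟩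
  rw [← hM] at hbud hh
  have hbudN : R.card + B.card + 4 * Fintype.card I + M * (16 * d + 16) + 2 * m ≤ D := by
    have h1 : (0 : ℝ) ≤ θ * Fintype.card V := by positivity
    exact_mod_cast (by linarith :
      (R.card : ℝ) + B.card + 4 * Fintype.card I + M * (16 * d + 16) + 2 * m ≤ D)
  -- the ends of the absorbing paths
  obtain ⟨a, haI, haG⟩ : ∃ a : I → V, Function.Injective a ∧ ∀ i, a i ∈
      (Finset.univ.filter fun v => τ ≤ (G.neighborFinset v ∩ R).card) \ (R ∪ B) := by
    have h1 := Finset.le_card_sdiff (R ∪ B)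
      (Finset.univ.filter fun v => τ ≤ (G.neighborFinset v ∩ R).card)
    have h2 := Finset.card_union_le R B
    obtain ⟨φ⟩ : Nonempty (I ↪ ↥((Finset.univ.filter fun v =>
        τ ≤ (G.neighborFinset v ∩ R).card) \ (R ∪ B))) :=
      Function.Embedding.nonempty_of_card_le (by rw [Fintype.card_coe]; omega)
    exact ⟨fun i => φ i, fun i j hij => φ.injective (Subtype.ext hij), fun i => (φ i).2⟩
  simp only [Finset.mem_sdiff, Finset.mem_filter, Finset.mem_univ, true_and, Finset.mem_union,
    not_or] at haG
  have hac : (Finset.univ.image a).card = Fintype.card I := by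
    rw [Finset.card_image_of_injective _ haI, Finset.card_univ]
  -- the gadgets
  obtain ⟨U₀, hU₀⟩ : ∃ U₀, U₀ = R ∪ B ∪ Finset.univ.image a := ⟨_, rfl⟩
  have hU₀c : U₀.card ≤ R.card + B.card + Fintype.card I := by
    have h1 := Finset.card_union_le (R ∪ B) (Finset.univ.image a)
    have h2 := Finset.card_union_le R B
    rw [hU₀]
    omega
  obtain ⟨A, hA, hAd⟩ := Finset.exists_pairwise_disjoint_of_small (ι := I × Fin k)
    (fun _ X => ∃ C e x y, G.IsSlotChain X C e x y ∧ (Finset.univ \ C).card ≤ h) U₀ (2 + 8 * d)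
    (R.card + B.card + Fintype.card I + M * (2 + 8 * d)) (by
      intro _ U _ hU
      obtain ⟨X, C, e, x, y, hch, hXU, hXc, hC⟩ := hJ.exists_slotChain hD hθ hθ1 d U (by
        have h1 : (U.card : ℝ) ≤ R.card + B.card + Fintype.card I + M * (2 + 8 * d) := by
          exact_mod_cast hU
        have h2 : (1 : ℝ) ≤ M := by exact_mod_cast hk.trans_le hkM
        have h3 : (0 : ℝ) ≤ d := by positivity
        have h4 : (0 : ℝ) ≤ Fintype.card I := by positivity
        nlinarith)
      exact ⟨X, ⟨C, e, x, y, hch, by exact_mod_cast hC.trans hcov⟩, hXc, hXU⟩) (by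
      rw [hι]
      omega)
  choose hAP hAc hAU using hA
  choose C e x y hch hC using hAP
  have hAabs : ∀ t, G.Absorbs C (e t) (y t) (A t) {t} := fun t => (hch t).absorbs
  simp only [hU₀, Finset.disjoint_union_right] at hAU
  -- vertices missed by many gadgets
  obtain ⟨Z, hZ⟩ : ∃ Z, Z = Finset.univ.filter fun v => Fintype.card (I × Fin k) <
    2 * (Finset.univ.filter fun t => v ∉ C t).card := ⟨_, rfl⟩
  have hZc : Z.card ≤ 2 * h := hZ ▸ Finset.card_filter_missed_le hC
  -- Only those bad vertices that lie neither in `B`, nor among the ends, nor in a gadget need a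
  -- place. The injection `ζ` deals them out, at most `k` to each path.
  obtain ⟨Z', hZ'⟩ : ∃ Z', Z' = Z \ (B ∪ Finset.univ.image a ∪ Finset.univ.biUnion A) :=
    ⟨_, rfl⟩
  have hZ'c : Z'.card ≤ 2 * h := (Finset.card_le_card (hZ' ▸ Finset.sdiff_subset)).trans hZc
  obtain ⟨ζ, hζ⟩ : ∃ ζ : V → I × Fin k, Set.InjOn ζ Z' := by
    obtain ⟨ψ⟩ : Nonempty (↥Z' ↪ I × Fin k) :=
      Function.Embedding.nonempty_of_card_le (by rw [Fintype.card_coe, hι]; omega)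
    refine ⟨fun v => if hv : v ∈ Z' then ψ ⟨v, hv⟩ else Classical.arbitrary _, ?_⟩
    intro v hv w hw hvw
    rw [Finset.mem_coe] at hv hw
    simp only [hv, hw, dif_pos] at hvw
    exact congrArg Subtype.val (ψ.injective hvw)
  obtain ⟨Zi, hZi⟩ : ∃ Zi : I → Finset V, Zi = fun i => Z'.filter fun v => (ζ v).1 = i :=
    ⟨_, rfl⟩
  have hZiZ : ∀ i, Zi i ⊆ Z' := fun i => by
    rw [hZi]
    exact Finset.filter_subset _ _
  have hZic : ∀ i, (Zi i).card ≤ k := by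
    intro i
    have h1 : (Zi i).card ≤ (Finset.univ : Finset (Fin k)).card := by
      refine Finset.card_le_card_of_injOn (fun v => (ζ v).2) (by simp) ?_
      intro v hv w hw hvw
      rw [Finset.mem_coe, hZi, Finset.mem_filter] at hv hw
      exact hζ hv.1 hw.1 (Prod.ext (hv.2.trans hw.2.symm) hvw)
    simpa using h1
  have hZ'n : ∀ v ∈ Z', v ∉ B ∧ (∀ i, a i ≠ v) ∧ ∀ t, v ∉ A t := by
    intro v hv
    rw [hZ'] at hv
    simpa [not_or, and_assoc] using (Finset.mem_sdiff.1 hv).2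
  -- linking the gadgets
  obtain ⟨U₁, hU₁⟩ : ∃ U₁, U₁ = U₀ ∪ Finset.univ.biUnion A ∪ Z' := ⟨_, rfl⟩
  have hU₁c : U₁.card ≤ R.card + B.card + Fintype.card I + M * (2 + 8 * d) + M := by
    have h1 := Finset.card_union_le (U₀ ∪ Finset.univ.biUnion A) Z'
    have h2 := Finset.card_union_le U₀ (Finset.univ.biUnion A)
    have h3 : (Finset.univ.biUnion A).card ≤ M * (2 + 8 * d) := by
      rw [← hι]
      exact Finset.card_biUnion_le_card_mul _ _ _ fun t _ => hAc t
    rw [hU₁]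
    omega
  have hScard : ∀ i : I, (({i} : Finset I) ×ˢ (Finset.univ : Finset (Fin k))).card = k := by
    simp
  obtain ⟨X, hX, hXd⟩ := Finset.exists_pairwise_disjoint_of_small (ι := I)
    (fun i Y => ∃ p, G.Adj (u i) p ∧ G.Absorbs C p (a i)
      (Y ∪ (({i} : Finset I) ×ˢ Finset.univ).biUnion A ∪ Zi i ∪ {a i})
      (({i} : Finset I) ×ˢ Finset.univ)) U₁ (4 * k + 3)
    (R.card + B.card + 4 * Fintype.card I + M * (8 * d + 7)) (by
      intro i U hUU hU
      obtain ⟨p, Y, hp, hY, hYc, hYU⟩ := hJ.exists_absorbs_from_to hD (C := C) (e := e) (f := y)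
        (A := A) (S := ({i} : Finset I) ×ˢ Finset.univ) (Z := Zi i) (U := U) (u := u i) (a := a i)
        (fun t _ => hAabs t) (fun s _ t _ hst => hAd hst)
        (fun t _ => Finset.disjoint_left.2 fun v hv => (hZ'n v (hZiZ i hv)).2.2 t)
        (fun t _ hat => Finset.disjoint_left.1 (hAU t).2 hat (by simp))
        (fun hai => (hZ'n _ (hZiZ i hai)).2.1 i rfl)
        (fun t _ => Finset.Subset.trans (fun v hv => by
          rw [hU₁]
          exact Finset.mem_union_left _ (Finset.mem_union_right _
            (Finset.mem_biUnion.2 ⟨t, Finset.mem_univ _, hv⟩))) hUU)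
        (((hZiZ i).trans (by rw [hU₁]; exact Finset.subset_union_right)).trans hUU)
        (hUU (by simp [hU₁, hU₀])) (by
          rw [hScard]
          have h1 := hZic i
          have h2 : M * (8 * d + 7) + 4 * M + 3 * M ≤ M * (16 * d + 16) := by nlinarith
          omega)
      refine ⟨Y, ⟨p, hp, hY⟩, hYc.trans ?_, hYU⟩
      rw [hScard]
      have := hZic i
      omega) (by
      have h1 : Fintype.card I * (4 * k + 3) = 4 * M + 3 * Fintype.card I := by rw [hM]; ring
      have h2 : M * (2 + 8 * d) + M + 4 * M = M * (8 * d + 7) := by ring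
      omega)
  choose hXP hXc hXU using hX
  choose p hp habs using hXP
  simp only [hU₁, hU₀, Finset.disjoint_union_right, Finset.disjoint_biUnion_right,
    Finset.mem_univ, true_implies, and_assoc] at hXU
  have haA : ∀ i t, a i ∉ A t := fun i t hat =>
    Finset.disjoint_left.1 (hAU t).2 hat (by simp)
  have haX : ∀ i j, a i ∉ X j := fun i j hat =>
    Finset.disjoint_left.1 (hXU j).2.2.1 hat (by simp)
  refine ⟨C, fun i => X i ∪ (({i} : Finset I) ×ˢ Finset.univ).biUnion A ∪ Zi i ∪ {a i}, p, a,
    hC, hp, habs, ?_, ?_, ?_, fun i => (haG i).1, ?_, ?_⟩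
  · intro i
    have h1 := Finset.card_union_le (X i ∪ (({i} : Finset I) ×ˢ Finset.univ).biUnion A ∪ Zi i)
      {a i}
    have h2 := Finset.card_union_le (X i ∪ (({i} : Finset I) ×ˢ Finset.univ).biUnion A) (Zi i)
    have h3 := Finset.card_union_le (X i) ((({i} : Finset I) ×ˢ Finset.univ).biUnion A)
    have h4 := Finset.card_biUnion_le_card_mul (({i} : Finset I) ×ˢ Finset.univ) A (2 + 8 * d)
      fun t _ => hAc t
    rw [hScard] at h4
    rw [Finset.card_singleton] at h1
    have h5 := hXc i
    have h6 := hZic i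
    have h7 : k * (8 * d + 7) = 4 * k + k * (2 + 8 * d) + k := by ring
    beta_reduce
    omega
  · intro i
    simp only [Finset.disjoint_union_left, Finset.disjoint_biUnion_left,
      Finset.disjoint_singleton_left]
    exact ⟨⟨⟨(hXU i).2.1, fun t _ => (hAU t).1.2⟩,
      Finset.disjoint_left.2 fun v hv => (hZ'n v (hZiZ i hv)).1⟩, (haG i).2.2⟩
  · intro i j hij
    have hAA : ∀ s ∈ ({i} : Finset I) ×ˢ (Finset.univ : Finset (Fin k)),
        ∀ t ∈ ({j} : Finset I) ×ˢ (Finset.univ : Finset (Fin k)), Disjoint (A s) (A t) := by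
      intro s hs t ht
      refine hAd ?_
      rintro rfl
      simp only [Finset.mem_product, Finset.mem_singleton, Finset.mem_univ, and_true] at hs ht
      exact hij (hs.symm.trans ht)
    have hZZ : Disjoint (Zi i) (Zi j) := by
      rw [Finset.disjoint_left]
      intro v hv hv'
      rw [hZi, Finset.mem_filter] at hv hv'
      exact hij (hv.2.symm.trans hv'.2)
    have hZA : ∀ l t, Disjoint (Zi l) (A t) := fun l t =>
      Finset.disjoint_left.2 fun v hv => (hZ'n v (hZiZ l hv)).2.2 t
    have hXZ : ∀ l l', Disjoint (X l) (Zi l') := fun l l' =>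
      ((hXU l).2.2.2.2).mono_right (hZiZ l')
    have haZ : ∀ l l', a l ∉ Zi l' := fun l l' hl => (hZ'n _ (hZiZ l' hl)).2.1 l rfl
    have haa : a i ≠ a j := fun h => hij (haI h)
    simp only [Finset.disjoint_union_left, Finset.disjoint_union_right,
      Finset.disjoint_biUnion_left, Finset.disjoint_biUnion_right,
      Finset.disjoint_singleton_left, Finset.disjoint_singleton_right]
    refine ⟨⟨⟨⟨⟨⟨hXd hij, fun t _ => ((hXU j).2.2.2.1 t).symm⟩, (hXZ j i).symm⟩, haX i j⟩,
      fun t ht => ⟨⟨⟨(hXU i).2.2.2.1 t, fun s hs => hAA s hs t ht⟩, hZA i t⟩, haA i t⟩⟩,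
      ⟨⟨⟨hXZ i j, fun t _ => (hZA j t).symm⟩, hZZ⟩, haZ i j⟩⟩,
      ?_⟩
    simp only [Finset.mem_union, Finset.mem_biUnion, Finset.mem_singleton, not_or, not_exists,
      not_and]
    exact ⟨⟨⟨haX j i, fun t _ => haA j t⟩, haZ j i⟩, haa.symm⟩
  -- Ends, gadgets and connectors all avoid `R`, so only vertices of `Z'` can lie in it.
  · refine (Finset.card_le_card (t := Z') ?_).trans hZ'c
    intro v hv
    rw [Finset.mem_inter, Finset.mem_biUnion] at hv
    obtain ⟨hvR, i, -, hvE⟩ := hv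
    simp only [Finset.mem_union, Finset.mem_biUnion, Finset.mem_singleton] at hvE
    rcases hvE with ((hv | ⟨t, -, hv⟩) | hv) | rfl
    · exact absurd hvR (Finset.disjoint_left.1 (hXU i).1 hv)
    · exact absurd hvR (Finset.disjoint_left.1 (hAU t).1.1 hv)
    · exact hZiZ i hv
    · exact absurd hvR (haG i).2.1
  · intro v hvB hvE
    by_contra! hcon
    have hvZ : v ∈ Z := by
      rw [hZ, Finset.mem_filter]
      exact ⟨Finset.mem_univ _, hcon⟩
    have hvZ' : v ∈ Z' := by
      rw [hZ', Finset.mem_sdiff]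
      refine ⟨hvZ, ?_⟩
      simp only [Finset.mem_union, Finset.mem_image, Finset.mem_biUnion, Finset.mem_univ, true_and,
        not_or, not_exists]
      refine ⟨⟨hvB, fun i hi => hvE i (by simp [hi])⟩, fun t ht => hvE t.1 ?_⟩
      simp only [Finset.mem_union, Finset.mem_biUnion]
      exact Or.inl (Or.inl (Or.inr ⟨t, by simp, ht⟩))
    refine hvE (ζ v).1 ?_
    simp only [Finset.mem_union]
    refine Or.inl (Or.inr ?_)
    rw [hZi, Finset.mem_filter]
    exact ⟨hvZ', rfl⟩

end SimpleGraph

/-! ### Segments of prescribed order and the spanning linkage -/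

namespace SimpleGraph

variable {V : Type*} {G : SimpleGraph V}

/-- A path of prescribed order inside `W`, extended at either end by one vertex of `X₁` and one
of `X₂`. -/
theorem IsJoined.exists_path_between [DecidableEq V] {m : ℕ} (hJ : G.IsJoined m)
    {X₁ X₂ W : Finset V} (hX₁ : m ≤ X₁.card) (hX₂ : 2 * m ≤ X₂.card) (h₁ : Disjoint X₁ W)
    (h₂ : Disjoint X₂ W) {l : ℕ} (hl : 0 < l) (hW : l + 4 * m ≤ W.card) :
    ∃ r ∈ X₁, ∃ q ∈ X₂, ∃ P ⊆ W, P.card = l ∧ r ≠ q ∧ G.HasPathOn r q ({r} ∪ P ∪ {q}) := by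
  classical
  obtain ⟨Y₁, hY₁, hY₁c⟩ := Finset.exists_subset_card_eq hX₁
  have h3 : m ≤ (X₂ \ Y₁).card := by
    have := Finset.le_card_sdiff Y₁ X₂
    omega
  obtain ⟨Y₂, hY₂, hY₂c⟩ := Finset.exists_subset_card_eq h3
  have hY₂X : Y₂ ⊆ X₂ := hY₂.trans Finset.sdiff_subset
  have hb₁ : (W.filter fun w => ∀ x ∈ Y₁, ¬ G.Adj x w).card < m :=
    hJ.card_lt_of_not_adj hY₁c.ge (h₁.mono hY₁ (Finset.filter_subset _ _))
      fun x hx w hw => (Finset.mem_filter.1 hw).2 x hx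
  have hb₂ : (W.filter fun w => ∀ x ∈ Y₂, ¬ G.Adj x w).card < m :=
    hJ.card_lt_of_not_adj hY₂c.ge (h₂.mono hY₂X (Finset.filter_subset _ _))
      fun x hx w hw => (Finset.mem_filter.1 hw).2 x hx
  -- After deleting fewer than `2 * m` vertices, every vertex has a neighbour in `Y₁` and one in
  -- `Y₂`, so any path inside `W'` can be extended at both ends.
  obtain ⟨W', hW'⟩ : ∃ W', W' = W \ ((W.filter fun w => ∀ x ∈ Y₁, ¬ G.Adj x w) ∪
    (W.filter fun w => ∀ x ∈ Y₂, ¬ G.Adj x w)) := ⟨_, rfl⟩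
  have hW'c : l + 2 * m ≤ W'.card := by
    have h4 := Finset.le_card_sdiff ((W.filter fun w => ∀ x ∈ Y₁, ¬ G.Adj x w) ∪
      (W.filter fun w => ∀ x ∈ Y₂, ¬ G.Adj x w)) W
    have h5 := Finset.card_union_le (W.filter fun w => ∀ x ∈ Y₁, ¬ G.Adj x w)
      (W.filter fun w => ∀ x ∈ Y₂, ¬ G.Adj x w)
    rw [hW']
    omega
  have hW'W : W' ⊆ W := by
    rw [hW']
    exact Finset.sdiff_subset
  have hW'n : ∀ w ∈ W', (∃ x ∈ Y₁, G.Adj x w) ∧ ∃ x ∈ Y₂, G.Adj x w := by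
    intro w hw
    have hwW := hW'W hw
    rw [hW', Finset.mem_sdiff, Finset.mem_union, not_or] at hw
    constructor
    · by_contra! hcon
      exact hw.2.1 (Finset.mem_filter.2 ⟨hwW, hcon⟩)
    · by_contra! hcon
      exact hw.2.2 (Finset.mem_filter.2 ⟨hwW, hcon⟩)
  obtain ⟨a, b, P, hP, hPW, hPc⟩ := hJ.exists_path_in W' l hl hW'c
  obtain ⟨r, hr, hra⟩ := (hW'n a (hPW hP.left_mem)).1
  obtain ⟨q, hq, hqb⟩ := (hW'n b (hPW hP.right_mem)).2
  have hrP : r ∉ P := fun h => Finset.disjoint_left.1 h₁ (hY₁ hr) (hW'W (hPW h))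
  have hqP : q ∉ P := fun h => Finset.disjoint_left.1 h₂ (hY₂X hq) (hW'W (hPW h))
  have hrq : r ≠ q := by
    rintro rfl
    exact (Finset.mem_sdiff.1 (hY₂ hq)).2 hr
  refine ⟨r, hY₁ hr, q, hY₂X hq, P, hPW.trans hW'W, hPc, hrq, ?_⟩
  exact ((HasPathOn.singleton r).append hP hra (by simpa using hrP)).append
    (HasPathOn.singleton q) hqb.symm (by simp [hqP, hrq.symm])

variable [Fintype V] [DecidableEq V] [DecidableRel G.Adj]

/-- Disjoint paths of prescribed orders from neighbours of `a i` to neighbours of `w i`, which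
avoid `F` and use few vertices of the reservoir `R`. -/
theorem IsJoined.exists_disjoint_segments {I : Type*} [Fintype I] {m : ℕ}
    (hJ : G.IsJoined m) (F R : Finset V) (hFR : Disjoint F R) (a w : I → V) (l : I → ℕ)
    (hl : ∀ i, 0 < l i)
    (ha : ∀ i, 2 * Fintype.card I + 2 * m ≤ (G.neighborFinset (a i) ∩ R).card)
    (hw : ∀ i, 2 * Fintype.card I + 2 * m ≤ (G.neighborFinset (w i) ∩ R).card)
    (hc : F.card + R.card + ∑ i, (l i + 2) + 4 * m ≤ Fintype.card V) :
    ∃ Y : I → Finset V, (∀ i, (Y i).card = l i + 2 ∧ Disjoint (Y i) F ∧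
      ∃ r q, G.HasPathOn r q (Y i) ∧ G.Adj (a i) r ∧ G.Adj q (w i)) ∧
      Pairwise fun i j => Disjoint (Y i) (Y j) := by
  classical
  -- The extra condition that a segment meets `R` at most twice keeps the reservoir usable for all
  -- later segments.
  obtain ⟨Y, hY, hYd⟩ := Finset.exists_pairwise_disjoint_of_extend (ι := I)
    (fun i X => (X.card = l i + 2 ∧ Disjoint X F ∧
      ∃ r q, G.HasPathOn r q X ∧ G.Adj (a i) r ∧ G.Adj q (w i)) ∧ (X ∩ R).card ≤ 2) (by
    intro S i Y hi hY hYd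
    obtain ⟨Q, hQ⟩ : ∃ Q, Q = S.biUnion Y := ⟨_, rfl⟩
    have hQc : Q.card ≤ ∑ j ∈ S, (l j + 2) := by
      rw [hQ]
      refine Finset.card_biUnion_le.trans (Finset.sum_le_sum fun j hj => (hY j hj).1.1.le)
    have hQR : (Q ∩ R).card ≤ 2 * S.card := by
      rw [hQ, Finset.biUnion_inter]
      exact (Finset.card_biUnion_le_card_mul _ _ 2 fun j hj => (hY j hj).2).trans_eq (mul_comm _ _)
    have hsum : ∑ j ∈ S, (l j + 2) + (l i + 2) ≤ ∑ j, (l j + 2) := by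
      have h1 := Finset.sum_insert (f := fun j => l j + 2) hi
      have h2 : ∑ j ∈ insert i S, (l j + 2) ≤ ∑ j, (l j + 2) :=
        Finset.sum_le_univ_sum_of_nonneg (by simp)
      omega
    have hSc : S.card ≤ Fintype.card I := Finset.card_le_univ S
    have hX : ∀ v, 2 * Fintype.card I + 2 * m ≤ (G.neighborFinset v ∩ R).card →
        2 * m ≤ ((G.neighborFinset v ∩ R) \ Q).card := by
      intro v hv
      have h1 := Finset.card_sdiff_add_card_inter (G.neighborFinset v ∩ R) Q
      have h2 : ((G.neighborFinset v ∩ R) ∩ Q).card ≤ (Q ∩ R).card := by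
        refine Finset.card_le_card fun x hx => ?_
        rw [Finset.mem_inter, Finset.mem_inter] at hx
        exact Finset.mem_inter.2 ⟨hx.2, hx.1.2⟩
      omega
    have hWd : ∀ v, Disjoint ((G.neighborFinset v ∩ R) \ Q) (Finset.univ \ (F ∪ R ∪ Q)) := by
      intro v
      rw [Finset.disjoint_left]
      intro x hx hx'
      rw [Finset.mem_sdiff, Finset.mem_inter] at hx
      exact (Finset.mem_sdiff.1 hx').2
        (Finset.mem_union_left _ (Finset.mem_union_right _ hx.1.2))
    obtain ⟨r, hr, q, hq, P, hPW, hPc, hrq, hP⟩ := hJ.exists_path_between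
      ((by omega : m ≤ 2 * m).trans (hX (a i) (ha i))) (hX (w i) (hw i)) (hWd _) (hWd _) (hl i)
      (by
        have h1 := Finset.le_card_sdiff (F ∪ R ∪ Q) Finset.univ
        rw [Finset.card_univ] at h1
        have h2 := Finset.card_union_le (F ∪ R) Q
        have h3 := Finset.card_union_le F R
        omega)
    simp only [Finset.mem_sdiff, Finset.mem_inter, mem_neighborFinset] at hr hq
    have hPn : ∀ x ∈ P, x ∉ F ∧ x ∉ R ∧ x ∉ Q := by
      intro x hx
      simpa [not_or, and_assoc] using (Finset.mem_sdiff.1 (hPW hx)).2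
    refine ⟨{r} ∪ P ∪ {q}, ⟨⟨?_, ?_, r, q, hP, hr.1.1, hq.1.1.symm⟩, ?_⟩, ?_⟩
    · rw [Finset.card_union_of_disjoint, Finset.card_union_of_disjoint, hPc]
      · simp
        omega
      · rw [Finset.disjoint_singleton_left]
        exact fun h => (hPn r h).2.1 hr.1.2
      · simp only [Finset.disjoint_singleton_right, Finset.mem_union, Finset.mem_singleton, not_or]
        exact ⟨hrq.symm, fun h => (hPn q h).2.1 hq.1.2⟩
    · simp only [Finset.disjoint_union_left, Finset.disjoint_singleton_left]
      exact ⟨⟨Finset.disjoint_right.1 hFR hr.1.2, Finset.disjoint_left.2 fun x hx => (hPn x hx).1⟩,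
        Finset.disjoint_right.1 hFR hq.1.2⟩
    · refine (Finset.card_le_card (t := {r, q}) ?_).trans Finset.card_le_two
      intro x hx
      simp only [Finset.mem_inter, Finset.mem_union, Finset.mem_singleton, Finset.mem_insert]
        at hx ⊢
      rcases hx with ⟨(hx | hx) | hx, hxR⟩
      · exact Or.inl hx
      · exact absurd hxR (hPn x hx).2.1
      · exact Or.inr hx
    · rw [← Finset.disjoint_biUnion_right, ← hQ]
      simp only [Finset.disjoint_union_left, Finset.disjoint_singleton_left]
      exact ⟨⟨hr.2, Finset.disjoint_left.2 fun x hx => (hPn x hx).2.2⟩, hq.2⟩)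
  exact ⟨Y, fun i => (hY i).1, hYd⟩

/-- A spanning system of disjoint paths of prescribed orders, where the `i`-th path starts next to
`u i` and ends next to `w i`. -/
theorem IsJoined.exists_spanning_linkage [Nonempty V] {I : Type*} [Fintype I] [Nonempty I]
    [DecidableEq I] {m D k d h τ : ℕ} {θ : ℝ} (hJ : G.IsJoined m) (hD : ∀ v, D ≤ G.degree v)
    (hθ : 0 < θ) (hθ1 : θ ≤ 1) (B R : Finset V) (u w : I → V) (s : I → ℕ) (hk : 0 < k)
    (hw : ∀ i, τ ≤ (G.neighborFinset (w i) ∩ R).card)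
    (hgood : R.card + B.card + Fintype.card I ≤
      (Finset.univ.filter fun v => τ ≤ (G.neighborFinset v ∩ R).card).card)
    (hcov : (1 - θ ^ 2) ^ d * Fintype.card V ≤ h)
    (hh : 2 * h ≤ Fintype.card I * k)
    (hbud : θ * Fintype.card V + R.card + B.card + 4 * Fintype.card I
      + (Fintype.card I * k : ℕ) * (16 * d + 16) + 2 * m ≤ D)
    (hτ : B.card + 2 * h + 2 * Fintype.card I + 2 * m ≤ τ)
    (hR : R.card + 4 * m ≤ Fintype.card I * k)
    (hs : ∑ i, s i + B.card = Fintype.card V)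
    (hsk : ∀ i, k * (8 * d + 8) + 7 ≤ s i) :
    ∃ (p q : I → V) (T : I → Finset V),
      (∀ i, G.Adj (u i) (p i) ∧ G.Adj (q i) (w i) ∧ G.HasPathOn (p i) (q i) (T i) ∧
        (T i).card = s i ∧ Disjoint (T i) B) ∧
      (Pairwise fun i j => Disjoint (T i) (T j)) ∧ ∀ v, v ∉ B → ∃ i, v ∈ T i := by
  obtain ⟨C, E, p, a, hC, hp, hE, hEc, hEB, hEd, haR, hER, hmiss⟩ :=
    hJ.exists_absorbing_paths hD hθ hθ1 B R u hk hgood hcov hh hbud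
  have hι : Fintype.card (I × Fin k) = Fintype.card I * k := by simp
  obtain ⟨F, hF⟩ : ∃ F, F = B ∪ Finset.univ.biUnion E := ⟨_, rfl⟩
  have hFc : F.card = B.card + ∑ i, (E i).card := by
    rw [hF, Finset.card_union_of_disjoint, Finset.card_biUnion fun i _ j _ hij => hEd hij]
    rw [Finset.disjoint_biUnion_right]
    exact fun i _ => (hEB i).symm
  -- The path for `i` consists of `E i`, `k` absorbed vertices and a segment with `l i` inner
  -- vertices and two ends in the reservoir. The bound `hsk` makes `l i` positive, so no subtraction
  -- truncates.
  obtain ⟨l, hl⟩ : ∃ l : I → ℕ, l = fun i => s i - (E i).card - k - 2 := ⟨_, rfl⟩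
  have hls : ∀ i, (E i).card + k + (l i + 2) = s i ∧ 0 < l i := by
    intro i
    have h1 := hEc i
    have h2 := hsk i
    have h3 : k * (8 * d + 8) = k * (8 * d + 7) + k := by ring
    simp only [hl]
    omega
  have hsum : ∑ i, (E i).card + Fintype.card I * k + ∑ i, (l i + 2) = ∑ i, s i := by
    rw [← Finset.sum_congr rfl fun i _ => (hls i).1]
    simp only [Finset.sum_add_distrib, Finset.sum_const, smul_eq_mul, Finset.card_univ]
  have hN : ∀ v, τ ≤ (G.neighborFinset v ∩ R).card →
      2 * Fintype.card I + 2 * m ≤ (G.neighborFinset v ∩ (R \ F)).card := by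
    intro v hv
    have h1 : G.neighborFinset v ∩ R ⊆
        (G.neighborFinset v ∩ (R \ F)) ∪ (B ∪ (R ∩ Finset.univ.biUnion E)) := by
      intro x hx
      simp only [Finset.mem_inter, Finset.mem_union, Finset.mem_sdiff, hF] at hx ⊢
      tauto
    have h2 := Finset.card_le_card h1
    have h3 := Finset.card_union_le (G.neighborFinset v ∩ (R \ F))
      (B ∪ (R ∩ Finset.univ.biUnion E))
    have h4 := Finset.card_union_le B (R ∩ Finset.univ.biUnion E)
    omega
  -- The |I|k vertices reserved for absorption leave room for `R` and the slack `4 * m`.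
  obtain ⟨Y, hY, hYd⟩ := hJ.exists_disjoint_segments F (R \ F) Finset.disjoint_sdiff a w l
    (fun i => (hls i).2) (fun i => hN _ (haR i)) (fun i => hN _ (hw i)) (by
      have h1 : (R \ F).card ≤ R.card := Finset.card_le_card Finset.sdiff_subset
      omega)
  choose hYc hYF r q hYp har hqw using hY
  obtain ⟨L, hL⟩ : ∃ L, L = Finset.univ \ (F ∪ Finset.univ.biUnion Y) := ⟨_, rfl⟩
  have hLc : L.card = Fintype.card (I × Fin k) := by
    have h1 : (F ∪ Finset.univ.biUnion Y).card = F.card + ∑ i, (l i + 2) := by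
      rw [Finset.card_union_of_disjoint, Finset.card_biUnion fun i _ j _ hij => hYd hij]
      · simp only [hYc]
      · rw [Finset.disjoint_biUnion_right]
        exact fun i _ => (hYF i).symm
    rw [hL, Finset.card_sdiff_of_subset (Finset.subset_univ _), Finset.card_univ, h1]
    omega
  have hLn : ∀ v ∈ L, v ∉ B ∧ (∀ i, v ∉ E i) ∧ ∀ i, v ∉ Y i := by
    intro v hv
    rw [hL, hF] at hv
    simpa [not_or, and_assoc] using hv
  obtain ⟨v, hvi, hvC, hvL⟩ := Finset.exists_transversal hLc
    (fun t => by
      have := hC t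
      omega)
    (fun v hv => hmiss v (hLn v hv).1 (hLn v hv).2.1)
  have hvL' : ∀ t, v t ∈ L := fun t => hvL ▸ Finset.mem_image_of_mem v (Finset.mem_univ t)
  have hEF : ∀ i, E i ⊆ F := by
    intro i x hx
    rw [hF]
    exact Finset.mem_union_right _ (Finset.mem_biUnion.2 ⟨i, Finset.mem_univ i, hx⟩)
  have hYE : ∀ i j, Disjoint (Y i) (E j) := fun i j => (hYF i).mono_right (hEF j)
  have hYB : ∀ i, Disjoint (Y i) B := fun i =>
    (hYF i).mono_right (by rw [hF]; exact Finset.subset_union_left)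
  obtain ⟨Q, hQ⟩ : ∃ Q : I → Finset V,
      Q = fun i => (({i} : Finset I) ×ˢ (Finset.univ : Finset (Fin k))).image v := ⟨_, rfl⟩
  have hQL : ∀ i, ∀ x ∈ Q i, x ∈ L := by
    intro i x hx
    rw [hQ, Finset.mem_image] at hx
    obtain ⟨t, -, rfl⟩ := hx
    exact hvL' t
  have hQc : ∀ i, (Q i).card = k := by
    intro i
    rw [hQ, Finset.card_image_of_injective _ hvi]
    simp
  have hQE : ∀ i j, Disjoint (Q i) (E j) := fun i j =>
    Finset.disjoint_left.2 fun x hx => (hLn x (hQL i x hx)).2.1 j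
  have hQY : ∀ i j, Disjoint (Q i) (Y j) := fun i j =>
    Finset.disjoint_left.2 fun x hx => (hLn x (hQL i x hx)).2.2 j
  have hQQ : ∀ i j, i ≠ j → Disjoint (Q i) (Q j) := by
    intro i j hij
    rw [Finset.disjoint_left]
    intro x hx hx'
    rw [hQ, Finset.mem_image] at hx hx'
    obtain ⟨t, ht, rfl⟩ := hx
    obtain ⟨t', ht', he⟩ := hx'
    rw [Finset.mem_product, Finset.mem_singleton] at ht ht'
    exact hij (ht.1.symm.trans ((congrArg Prod.fst (hvi he)).symm.trans ht'.1))
  have hd : ∀ i, Disjoint (E i ∪ Q i) (Y i) := fun i =>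
    Finset.disjoint_union_left.2 ⟨(hYE i i).symm, hQY i i⟩
  refine ⟨p, q, fun i => E i ∪ Q i ∪ Y i, fun i => ⟨hp i, hqw i, ?_, ?_, ?_⟩, ?_, ?_⟩
  · have h1 := hE i v hvi.injOn (fun t _ => hvC t) fun t _ => (hLn _ (hvL' t)).2.1 i
    have h2 := h1.append (hYp i) (har i) (by
      have := hd i
      rwa [hQ] at this)
    rw [hQ]
    exact h2
  · rw [Finset.card_union_of_disjoint (hd i), Finset.card_union_of_disjoint (hQE i i).symm, hYc,
      hQc, (hls i).1]
  · simp only [Finset.disjoint_union_left]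
    exact ⟨⟨hEB i, Finset.disjoint_left.2 fun x hx => (hLn x (hQL i x hx)).1⟩, hYB i⟩
  · intro i j hij
    simp only [Finset.disjoint_union_left, Finset.disjoint_union_right]
    exact ⟨⟨⟨⟨hEd hij, hQE i j⟩, hYE i j⟩, ⟨(hQE j i).symm, hQQ i j hij⟩, (hQY j i).symm⟩,
      ⟨(hYE j i).symm, hQY i j⟩, hYd hij⟩
  · intro x hxB
    by_cases hxL : x ∈ L
    · rw [← hvL, Finset.mem_image] at hxL
      obtain ⟨t, -, rfl⟩ := hxL
      refine ⟨t.1, Finset.mem_union_left _ (Finset.mem_union_right _ ?_)⟩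
      rw [hQ]
      exact Finset.mem_image_of_mem v (by simp)
    · rw [hL, Finset.mem_sdiff, not_and_not_right] at hxL
      have h1 := hxL (Finset.mem_univ x)
      rw [hF] at h1
      simp only [Finset.mem_union, Finset.mem_biUnion, Finset.mem_univ, true_and] at h1
      rcases h1 with (h1 | ⟨i, h1⟩) | ⟨i, h1⟩
      · exact absurd h1 hxB
      · exact ⟨i, Finset.mem_union_left _ (Finset.mem_union_left _ h1)⟩
      · exact ⟨i, Finset.mem_union_right _ h1⟩

end SimpleGraph

/-! ### From a linkage to a subdivision -/

namespace SimpleGraph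

variable {V : Type*} {G : SimpleGraph V}

/-- Disjoint paths whose ends are adjacent to the appropriate branch vertices give a subdivision
of a complete graph. -/
theorem exists_subdivisionIn_of_linkage [DecidableEq V] {t : ℕ} {b : Fin t → V}
    (hb : Function.Injective b) {p q : {x : Fin t × Fin t // x.1 < x.2} → V}
    {T : {x : Fin t × Fin t // x.1 < x.2} → Finset V}
    (hT : ∀ i, G.Adj (b i.1.1) (p i) ∧ G.Adj (q i) (b i.1.2) ∧ G.HasPathOn (p i) (q i) (T i))
    (hTb : ∀ i z, b z ∉ T i) (hTd : Pairwise fun i j => Disjoint (T i) (T j))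
    (hcov : ∀ v, v ∉ Set.range b → ∃ i, v ∈ T i) :
    ∃ S : SubdivisionIn (completeGraph (Fin t)) G, S.toSubgraph.IsSpanning ∧
      ∀ x y (h : (completeGraph (Fin t)).Adj x y), ∃ i, (S.path h).length = (T i).card + 1 := by
  have hpath : ∀ i : {x : Fin t × Fin t // x.1 < x.2},
      G.HasPathOn (b i.1.1) (b i.1.2) ({b i.1.1} ∪ T i ∪ {b i.1.2}) := by
    intro i
    have hne : b i.1.2 ≠ b i.1.1 := fun h => i.2.ne' (hb h)
    exact ((HasPathOn.singleton _).append (hT i).2.2 (hT i).1 (by simpa using hTb i _)).append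
      (HasPathOn.singleton _) (hT i).2.1 (by simp [hne, hTb i])
  choose W hW hWs using hpath
  have hWl : ∀ i, (W i).length = (T i).card + 1 := by
    intro i
    have hne : b i.1.2 ≠ b i.1.1 := fun h => i.2.ne' (hb h)
    have h1 := HasPathOn.card_eq (hW i) (hWs i)
    rw [Finset.card_union_of_disjoint (by simp [hne, hTb i]),
      Finset.card_union_of_disjoint (by simpa using hTb i _)] at h1
    simp only [Finset.card_singleton] at h1
    omega
  -- Each path is built once, for x < y, and reversed for the opposite orientation, which yields
  -- `path_symm`.
  obtain ⟨P, hP⟩ : ∃ P : ∀ {x y : Fin t}, (completeGraph (Fin t)).Adj x y → G.Walk (b x) (b y),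
      ∀ x y (h : (completeGraph (Fin t)).Adj x y),
        (∀ hxy : x < y, P h = W ⟨(x, y), hxy⟩) ∧
        (∀ hxy : y < x, P h = (W ⟨(y, x), hxy⟩).reverse) := by
    refine ⟨fun {x y} h => if hxy : x < y then W ⟨(x, y), hxy⟩ else
      (W ⟨(y, x), lt_of_le_of_ne (not_lt.1 hxy) h.ne'⟩).reverse, fun x y h => ⟨?_, ?_⟩⟩
    · intro hxy
      exact dif_pos hxy
    · intro hxy
      exact dif_neg (not_lt.2 hxy.le)
  have hspec : ∀ x y (h : (completeGraph (Fin t)).Adj x y),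
      ∃ i : {x : Fin t × Fin t // x.1 < x.2}, s(i.1.1, i.1.2) = s(x, y) ∧ (P h).IsPath ∧
        (P h).length = (T i).card + 1 ∧
        ∀ z, z ∈ (P h).support ↔ z = b x ∨ z = b y ∨ z ∈ T i := by
    intro x y h
    rcases lt_or_gt_of_ne h.ne with hxy | hxy
    · refine ⟨⟨(x, y), hxy⟩, rfl, ?_⟩
      rw [(hP x y h).1 hxy]
      refine ⟨hW _, hWl _, fun z => ?_⟩
      rw [hWs]
      simp only [Finset.mem_union, Finset.mem_singleton]
      tauto
    · refine ⟨⟨(y, x), hxy⟩, Sym2.eq_swap, ?_⟩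
      rw [(hP x y h).2 hxy]
      refine ⟨(hW _).reverse, (Walk.length_reverse _).trans (hWl _), fun z => ?_⟩
      rw [Walk.support_reverse, List.mem_reverse, hWs]
      simp only [Finset.mem_union, Finset.mem_singleton]
      tauto
  let S : SubdivisionIn (completeGraph (Fin t)) G :=
    { branch := b
      branch_injective := hb
      path := P
      path_symm := by
        intro x y h
        rcases lt_or_gt_of_ne h.ne with hxy | hxy
        · rw [(hP x y h).1 hxy, (hP y x h.symm).2 hxy]
        · rw [(hP x y h).2 hxy, (hP y x h.symm).1 hxy, Walk.reverse_reverse]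
      isPath := fun {x y} h => by
        obtain ⟨-, -, hp, -⟩ := hspec x y h
        exact hp
      branch_mem := by
        intro x y h z hz
        obtain ⟨i, -, -, -, hs⟩ := hspec x y h
        rcases (hs _).1 hz with h1 | h1 | h1
        · exact Or.inl (hb h1)
        · exact Or.inr (hb h1)
        · exact absurd h1 (hTb i z)
      internally_disjoint := by
        intro x y x' y' h h' hne v hv hv'
        obtain ⟨i, hi, -, -, hs⟩ := hspec x y h
        obtain ⟨i', hi', -, -, hs'⟩ := hspec x' y' h'
        rcases (hs _).1 hv with rfl | rfl | h1
        · exact ⟨x, rfl⟩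
        · exact ⟨y, rfl⟩
        rcases (hs' _).1 hv' with rfl | rfl | h2
        · exact ⟨x', rfl⟩
        · exact ⟨y', rfl⟩
        have hii : i ≠ i' := by
          rintro rfl
          exact hne (hi.symm.trans hi')
        exact absurd h2 (Finset.disjoint_left.1 (hTd hii) h1) }
  refine ⟨S, ?_, ?_⟩
  · intro v
    by_cases hv : v ∈ Set.range b
    · obtain ⟨z, rfl⟩ := hv
      refine Or.inl ?_
      simp only [Subgraph.verts_iSup, Set.mem_iUnion]
      exact ⟨z, rfl⟩
    · obtain ⟨i, hi⟩ := hcov v hv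
      have hadj : (completeGraph (Fin t)).Adj i.1.1 i.1.2 := i.2.ne
      refine Or.inr ?_
      simp only [Subgraph.verts_iSup, Set.mem_iUnion]
      refine ⟨i.1.1, i.1.2, hadj, ?_⟩
      rw [Walk.mem_verts_toSubgraph]
      change v ∈ (P hadj).support
      rw [(hP _ _ hadj).1 i.2, hWs]
      simp [hi]
  · intro x y h
    obtain ⟨i, -, -, hl, -⟩ := hspec x y h
    exact ⟨i, hl⟩

end SimpleGraph

/-! ### Splitting evenly, and the choice of constants -/

/-- A natural number can be split as evenly as possible. -/
theorem Finset.exists_sum_eq_of_div (I : Type*) [Fintype I] [Nonempty I] (N : ℕ) :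
    ∃ s : I → ℕ, ∑ i, s i = N ∧
      ∀ i, N / Fintype.card I ≤ s i ∧ s i ≤ N / Fintype.card I + 1 := by
  classical
  have hlt := Nat.mod_lt N (Fintype.card_pos (α := I))
  obtain ⟨A, -, hA⟩ := Finset.exists_subset_card_eq (s := (Finset.univ : Finset I))
    (n := N % Fintype.card I) (by rw [Finset.card_univ]; exact hlt.le)
  refine ⟨fun i => N / Fintype.card I + if i ∈ A then 1 else 0, ?_, ?_⟩
  · rw [Finset.sum_add_distrib, Finset.sum_const, Finset.card_univ, smul_eq_mul,
      Finset.sum_ite_mem, Finset.univ_inter, Finset.sum_const, hA, smul_eq_mul, mul_one]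
    exact Nat.div_add_mod _ _
  · intro i
    dsimp only
    split_ifs <;> omega

namespace SimpleGraph

/-- Parameters `d`, `η` of the absorbing structure in graphs of relative minimum degree `μ`. -/
theorem exists_absorber_params {μ : ℝ} (hμ : 0 < μ) (hμ1 : μ ≤ 1) :
    ∃ d : ℕ, 0 < (1 - (μ / 2) ^ 2) ^ d ∧
      1600 * ((1 - (μ / 2) ^ 2) ^ d * (16 * d + 17)) ≤ μ ^ 2 := by
  have hr0 : 0 < 1 - (μ / 2) ^ 2 := by nlinarith
  have hr1 : 1 - (μ / 2) ^ 2 < 1 := by nlinarith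
  -- The exceptional proportion decays exponentially in `d`, whereas gadgets grow only linearly.
  have h1 := tendsto_self_mul_const_pow_of_lt_one hr0.le hr1
  have h2 := tendsto_pow_atTop_nhds_zero_of_lt_one hr0.le hr1
  have h3 := ((h1.const_mul 16).add (h2.const_mul 17)).const_mul 1600
  simp only [mul_zero, add_zero] at h3
  obtain ⟨d, hd⟩ := (h3.eventually_lt_const (show (0 : ℝ) < μ ^ 2 by positivity)).exists
  exact ⟨d, pow_pos hr0 d, by linarith⟩

/-- Constants depending only on the relative minimum degree. -/
theorem exists_linkage_constants {μ : ℝ} (hμ0 : 0 < μ) (hμ1 : μ ≤ 1) :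
    ∃ (d b : ℕ) (η β : ℝ), 0 < η ∧ η = (1 - (μ / 2) ^ 2) ^ d ∧ 27200 * η ≤ 1 ∧ 0 < β ∧
      μ * β = 400 * η ∧ 4 * (β * (16 * d + 17)) ≤ μ ∧ 0 < b ∧ 8 ≤ β * b ∧ β * b ≤ 9 := by
  obtain ⟨d, hη, hd⟩ := exists_absorber_params hμ0 hμ1
  obtain ⟨η, hηd⟩ : ∃ η, η = (1 - (μ / 2) ^ 2) ^ d := ⟨_, rfl⟩
  rw [← hηd] at hη hd
  have hη1 : 1600 * η * 17 ≤ 1 := by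
    have h1 : (0 : ℝ) ≤ η * d := by positivity
    nlinarith
  -- βn will be roughly the total number of gadgets: large compared with ηn, yet small enough that
  -- all gadgets together occupy at most a fraction of μn.
  obtain ⟨β, hβ⟩ : ∃ β, β = 400 * η / μ := ⟨_, rfl⟩
  have hβ0 : 0 < β := by rw [hβ]; positivity
  have hβμ : μ * β = 400 * η := by rw [hβ]; field_simp
  have hβd : 4 * (β * (16 * d + 17)) ≤ μ := by
    have h1 : μ * (4 * (β * (16 * d + 17))) ≤ μ * μ := by
      calc μ * (4 * (β * (16 * d + 17))) = 4 * (μ * β) * (16 * d + 17) := by ring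
        _ = 1600 * (η * (16 * d + 17)) := by rw [hβμ]; ring
        _ ≤ μ * μ := by linarith [sq μ]
    exact le_of_mul_le_mul_left h1 hμ0
  -- The reservoir has about n/b vertices, at most about an eighth of the number of gadgets.
  obtain ⟨b, hb⟩ : ∃ b, b = ⌈8 / β⌉₊ := ⟨_, rfl⟩
  have hb8 : 8 ≤ β * b := by
    have h1 : 8 / β ≤ b := hb ▸ Nat.le_ceil _
    rw [div_le_iff₀ hβ0] at h1
    linarith
  have hβ1 : β ≤ 1 := by
    have h1 : (0 : ℝ) ≤ β * d := by positivity
    nlinarith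
  have hb9 : β * b ≤ 9 := by
    have h1 : (b : ℝ) < 8 / β + 1 := hb ▸ Nat.ceil_lt_add_one (by positivity)
    have h2 : β * b < β * (8 / β + 1) := by gcongr
    have h3 : β * (8 / β + 1) = 8 + β := by field_simp
    linarith
  have hb0 : 0 < b := by
    rcases Nat.eq_zero_or_pos b with h | h
    · rw [h] at hb8
      norm_num at hb8
    · exact h
  exact ⟨d, b, η, β, hη, hηd, by linarith, hβ0, hβμ, hβd, hb0, hb8, hb9⟩

set_option maxHeartbeats 1000000 in
/-- Sizes of the parts of the construction for a large number `n` of vertices. -/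
theorem exists_linkage_sizes {μ η β : ℝ} {d b n t N D m : ℕ} (hμ0 : 0 < μ) (hμ1 : μ ≤ 1)
    (hη : 0 < η) (hη1 : 27200 * η ≤ 1) (hβ0 : 0 < β) (hβμ : μ * β = 400 * η)
    (hβd : 4 * (β * (16 * d + 17)) ≤ μ) (hb0 : 0 < b) (hb8 : 8 ≤ β * b) (hb9 : β * b ≤ 9)
    (hn0 : 0 < n) (hn : 100 / η ≤ n) (hbn : b ≤ n) (hm : m = ⌈η / 4 * (n : ℝ)⌉₊)
    (hN0 : 0 < N) (hNt : N ≤ t * t) (ht : 2 ≤ t) (htn : (t : ℝ) ≤ η / 2 * Real.sqrt n)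
    (hD : μ * n ≤ D) :
    ∃ k h τ r g : ℕ, 0 < k ∧ η * n ≤ h ∧ n ≤ b * r ∧ b * (g * r + n * τ) < n * D ∧
      r + t + N ≤ g ∧ t + N * (k * (8 * d + 8) + 7) ≤ n ∧ 2 * h ≤ N * k ∧
      μ / 2 * n + r + t + 4 * N + (N * k : ℕ) * (16 * d + 16) + 2 * m ≤ D ∧
      t + 2 * h + 2 * N + 2 * m ≤ τ ∧ r + 4 * m ≤ N * k := by
  obtain ⟨x, hx⟩ : ∃ x : ℝ, x = η * n := ⟨_, rfl⟩
  have hx100 : 100 ≤ x := by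
    rw [div_le_iff₀ hη] at hn
    linarith
  have hnR : (0 : ℝ) < n := by exact_mod_cast hn0
  obtain ⟨y, hy⟩ : ∃ y : ℝ, y = β * n := ⟨_, rfl⟩
  have hy0 : 0 ≤ y := by rw [hy]; positivity
  have hμy : μ * y = 400 * x := by
    rw [hy, hx, ← mul_assoc, hβμ]
    ring
  have hxy : 400 * x ≤ y := by
    rw [← hμy]
    nlinarith
  have hyd : 4 * (y * (16 * d + 17)) ≤ μ * n := by
    calc 4 * (y * (16 * d + 17)) = 4 * (β * (16 * d + 17)) * n := by rw [hy]; ring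
      _ ≤ μ * n := by gcongr
  have hμn : μ * n ≤ n := by nlinarith
  have hyd0 : (0 : ℝ) ≤ y * d := by positivity
  have htt : (t : ℝ) * t ≤ x / 4 := by
    have h1 : (t : ℝ) * t ≤ (η / 2 * Real.sqrt n) * (η / 2 * Real.sqrt n) := by gcongr
    have h2 : (η / 2 * Real.sqrt n) * (η / 2 * Real.sqrt n) = η / 4 * x := by
      rw [show (η / 2 * Real.sqrt n) * (η / 2 * Real.sqrt n)
        = η ^ 2 / 4 * (Real.sqrt n * Real.sqrt n) by ring, Real.mul_self_sqrt hnR.le, hx]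
      ring
    nlinarith
  have htt' : (t : ℝ) ≤ x / 4 := by
    have h1 : (2 : ℝ) ≤ t := by exact_mod_cast ht
    nlinarith
  have hNt : (N : ℝ) ≤ x / 4 := by
    have h2 : (N : ℝ) ≤ t * t := by exact_mod_cast hNt
    linarith
  obtain ⟨k, hk⟩ : ∃ k, k = ⌊y / N⌋₊ := ⟨_, rfl⟩
  have hNR : (0 : ℝ) < N := by exact_mod_cast hN0
  have hM₁ : ((N * k : ℕ) : ℝ) ≤ y := by
    have h1 : (k : ℝ) ≤ y / N := hk ▸ Nat.floor_le (by positivity)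
    rw [le_div_iff₀ hNR] at h1
    push_cast
    linarith
  have hM₂ : y - N ≤ ((N * k : ℕ) : ℝ) := by
    have h1 : y / N < k + 1 := hk ▸ Nat.lt_floor_add_one _
    rw [div_lt_iff₀ hNR] at h1
    push_cast
    linarith
  have hk0 : 0 < k := by
    rcases Nat.eq_zero_or_pos k with h | h
    · rw [h] at hM₂
      simp only [mul_zero, Nat.cast_zero] at hM₂
      linarith
    · exact h
  have hmx : (m : ℝ) ≤ x / 4 + 1 := by
    have h1 : (m : ℝ) < η / 4 * n + 1 := hm ▸ Nat.ceil_lt_add_one (by positivity)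
    rw [hx]
    linarith
  obtain ⟨h, hh⟩ : ∃ h, h = ⌈η * (n : ℝ)⌉₊ := ⟨_, rfl⟩
  have hhx : (h : ℝ) ≤ x + 1 := by
    have h1 : (h : ℝ) < η * n + 1 := hh ▸ Nat.ceil_lt_add_one (by positivity)
    rw [hx]
    linarith
  have hxh : η * n ≤ h := hh ▸ Nat.le_ceil _
  have hbR : (0 : ℝ) < b := by exact_mod_cast hb0
  obtain ⟨r, hr⟩ : ∃ r, r = n / b + 1 := ⟨_, rfl⟩
  have hbr : n ≤ b * r := by
    have := Nat.lt_mul_div_succ n hb0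
    rw [hr]
    exact this.le
  have hbr2 : b * r ≤ 2 * n := by
    have := Nat.mul_div_le n b
    rw [hr]
    linarith
  have hry : (r : ℝ) ≤ y / 8 + 1 := by
    have h1 : (b : ℝ) * (n / b : ℕ) ≤ n := by exact_mod_cast Nat.mul_div_le n b
    have h2 : 8 * ((n / b : ℕ) : ℝ) ≤ β * b * (n / b : ℕ) := by gcongr
    have h3 : β * (b * ((n / b : ℕ) : ℝ)) ≤ β * n := by gcongr
    rw [hr]
    push_cast
    rw [hy]
    linarith
  obtain ⟨g, hg⟩ : ∃ g, g = ⌊μ * n / 8⌋₊ := ⟨_, rfl⟩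
  have hg₁ : (g : ℝ) ≤ μ * n / 8 := hg ▸ Nat.floor_le (by positivity)
  have hg₂ : μ * n / 8 < g + 1 := hg ▸ Nat.lt_floor_add_one _
  -- Since βb ≤ 9 and μβ = 400η, τ is about μn/(4b) ≥ 400ηn/36 > 11ηn, well above the roughly 3.25ηn
  -- that `t + 2 * h + 2 * N + 2 * m` can reach.
  obtain ⟨τ, hτ⟩ : ∃ τ, τ = ⌊μ * n / (4 * b)⌋₊ := ⟨_, rfl⟩
  have hτ₁ : (b : ℝ) * τ ≤ μ * n / 4 := by
    have h1 : (τ : ℝ) ≤ μ * n / (4 * b) := hτ ▸ Nat.floor_le (by positivity)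
    rw [le_div_iff₀ (by positivity)] at h1
    linarith
  have hτ₂ : 11 * x ≤ τ + 1 := by
    have h1 : μ * n / (4 * b) < τ + 1 := hτ ▸ Nat.lt_floor_add_one _
    refine le_trans ?_ h1.le
    rw [le_div_iff₀ (by positivity)]
    have h2 : μ * n * (β * b) = 400 * x * b := by
      rw [← hμy, hy]
      ring
    have h3 : μ * n * (β * b) ≤ μ * n * 9 := by gcongr
    nlinarith
  refine ⟨k, h, τ, r, g, hk0, hxh, hbr, ?_, ?_, ?_, ?_, ?_, ?_, ?_⟩
  · have h1 : (b : ℝ) * r ≤ 2 * n := by exact_mod_cast hbr2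
    have h2 : (g : ℝ) * (b * r) ≤ μ * n / 8 * (2 * n) := by gcongr
    have h3 : (n : ℝ) * (b * τ) ≤ n * (μ * n / 4) := by gcongr
    have h4 : (n : ℝ) * (μ * n) ≤ n * D := by gcongr
    have h5 : 0 < μ * n * n := by positivity
    have h6 : (b : ℝ) * (g * r + n * τ) < n * D := by linarith
    exact_mod_cast h6
  · have h1 : (r : ℝ) + t + N ≤ g := by linarith
    exact_mod_cast h1
  · have h1 : ((N * k : ℕ) : ℝ) * (8 * d + 8) ≤ y * (8 * d + 8) := by gcongr
    have h2 : (t : ℝ) + (((N * k : ℕ) : ℝ) * (8 * d + 8) + 7 * N) ≤ n := by linarith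
    have h3 : t + (N * k * (8 * d + 8) + 7 * N) ≤ n := by exact_mod_cast h2
    have h4 : N * (k * (8 * d + 8) + 7) = N * k * (8 * d + 8) + 7 * N := by ring
    omega
  · have h1 : 2 * (h : ℝ) ≤ ((N * k : ℕ) : ℝ) := by linarith
    exact_mod_cast h1
  · have h1 : ((N * k : ℕ) : ℝ) * (16 * d + 16) ≤ y * (16 * d + 16) := by gcongr
    linarith
  · have h1 : (t : ℝ) + 2 * h + 2 * N + 2 * m ≤ τ := by linarith
    exact_mod_cast h1
  · have h1 : (r : ℝ) + 4 * m ≤ ((N * k : ℕ) : ℝ) := by linarith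
    exact_mod_cast h1

end SimpleGraph

/-! ### The main theorem -/

theorem theorem1p4 (μ : ℝ) (hμ : 0 < μ) :
    ∃ c ε : ℝ, 0 < c ∧ c ≤ 1 ∧ 0 < ε ∧ ε ≤ 1 ∧ ∃ n₀ : ℕ, ∀ n : ℕ, n₀ ≤ n →
      ∀ (V : Type*) [Fintype V] (G : SimpleGraph V) [DecidableRel G.Adj],
        Fintype.card V = n →
        G.IsJoined ⌈ε * (n : ℝ)⌉₊ →
        μ * (n : ℝ) ≤ (G.minDegree : ℝ) →
        ∀ t : ℕ, 2 ≤ t → (t : ℝ) ≤ c * Real.sqrt (n : ℝ) →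
          ∃ S : SimpleGraph.SubdivisionIn (SimpleGraph.completeGraph (Fin t)) G,
            S.toSubgraph.IsSpanning ∧ S.IsNearlyBalanced := by
  obtain ⟨μ', hμ'0, hμ'1, hμ'μ⟩ : ∃ μ' : ℝ, 0 < μ' ∧ μ' ≤ 1 ∧ μ' ≤ μ :=
    ⟨min μ 1, by positivity, min_le_right _ _, min_le_left _ _⟩
  obtain ⟨d, b, η, β, hη, hηd, hη1, hβ0, hβμ, hβd, hb0, hb8, hb9⟩ :=
    SimpleGraph.exists_linkage_constants hμ'0 hμ'1
  -- The bound on `n` gives ηn ≥ 100, which absorbs all rounding errors; c = η/2 keeps t² below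
  -- ηn/4.
  refine ⟨η / 2, η / 4, by positivity, by linarith, by positivity, by linarith,
    max ⌈100 / η⌉₊ b, ?_⟩
  intro n hn V _ G _ hV hJ hδ t ht htn
  classical
  have hbn : b ≤ n := (le_max_right _ _).trans hn
  have hn0 : 0 < n := hb0.trans_le hbn
  have : Nonempty V := Fintype.card_pos_iff.1 (hV ▸ hn0)
  have hI : Nonempty {x : Fin t × Fin t // x.1 < x.2} :=
    ⟨⟨(⟨0, by omega⟩, ⟨1, by omega⟩), by simp [Fin.lt_def]⟩⟩
  obtain ⟨k, h, τ, r, g, hk0, hh, hbr, hlt, hg, hsk, hhk, hbud, hτ, hr⟩ :=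
    SimpleGraph.exists_linkage_sizes (n := n) (t := t)
      (N := Fintype.card {x : Fin t × Fin t // x.1 < x.2}) (D := G.minDegree) hμ'0 hμ'1 hη hη1
      hβ0 hβμ hβd hb0 hb8 hb9 hn0
      ((Nat.le_ceil _).trans (by exact_mod_cast (le_max_left _ _).trans hn)) hbn rfl
      Fintype.card_pos ((Fintype.card_subtype_le _).trans_eq (by simp)) ht htn
      (le_trans (by gcongr) hδ)
  have hD : ∀ v, G.minDegree ≤ G.degree v := fun v => G.minDegree_le_degree v
  obtain ⟨R, hRc, hRg⟩ := SimpleGraph.exists_reservoir hD (hV.le.trans hbr) (by rw [hV]; exact hlt)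
  obtain ⟨br, hbri, hbrτ⟩ : ∃ br : Fin t → V, Function.Injective br ∧
      ∀ z, τ ≤ (G.neighborFinset (br z) ∩ R).card := by
    obtain ⟨φ⟩ : Nonempty (Fin t ↪ ↥(Finset.univ.filter fun v =>
        τ ≤ (G.neighborFinset v ∩ R).card)) :=
      Function.Embedding.nonempty_of_card_le (by
        rw [Fintype.card_coe, Fintype.card_fin]
        omega)
    exact ⟨fun z => φ z, fun z z' hz => φ.injective (Subtype.ext hz),
      fun z => (Finset.mem_filter.1 (φ z).2).2⟩
  have hBc : (Finset.univ.image br).card = t := by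
    rw [Finset.card_image_of_injective _ hbri, Finset.card_univ, Fintype.card_fin]
  obtain ⟨s, hs, hsb⟩ := Finset.exists_sum_eq_of_div {x : Fin t × Fin t // x.1 < x.2} (n - t)
  obtain ⟨p, q, T, hT, hTd, hTc⟩ := hJ.exists_spanning_linkage (k := k) (d := d) (h := h)
    (τ := τ) (θ := μ' / 2) hD (by positivity) (by linarith) (Finset.univ.image br) R
    (fun i => br i.1.1) (fun i => br i.1.2) s hk0 (fun i => hbrτ _)
    (by rw [hBc]; omega) (by rw [← hηd, hV]; exact hh) hhk
    (by
      rw [hBc, hV]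
      have h1 : (R.card : ℝ) ≤ r := by exact_mod_cast hRc
      linarith)
    (by rw [hBc]; exact hτ) (by omega) (by rw [hs, hBc, hV]; omega)
    (fun i => le_trans (by
      rw [Nat.le_div_iff_mul_le Fintype.card_pos, mul_comm]
      omega) (hsb i).1)
  obtain ⟨S, hS, hSl⟩ := SimpleGraph.exists_subdivisionIn_of_linkage hbri (p := p) (q := q)
    (T := T) (fun i => ⟨(hT i).1, (hT i).2.1, (hT i).2.2.1⟩)
    (fun i z hz => Finset.disjoint_left.1 (hT i).2.2.2.2 hz (by simp)) hTd
    (fun v hv => hTc v (by simpa using hv))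
  -- A path with s interior vertices has length s + 1, so with this ℓ all lengths are ℓ or ℓ + 1.
  refine ⟨S, hS, (n - t) / Fintype.card {x : Fin t × Fin t // x.1 < x.2} + 1, Nat.le_add_left _ _, ?_⟩
  intro x y hxy
  obtain ⟨i, hi⟩ := hSl x y hxy
  rw [hi, (hT i).2.2.2.1]
  have := hsb i
  omega
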